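/- Let $m\ge 1$ be an integer, let $S$ be a non-empty subset of $(\mathbb{Z}/m\mathbb{Z})^{\times}$, and let $A$ be the set of positive integers $n$ whose residue class modulo $m$ belongs to $S$. Let $f$ be a random completely multiplicative function with values $\pm1$: the values $f(p)$ at the primes $p$ are independent, $f(p)=1$ and $f(p)=-1$ each with probability $1/2$, and $f$ is extended to all positive integers completely multiplicatively. Expand the characteristic function of $S$ into the characters $\chi$ of $(\mathbb{Z}/m\mathbb{Z})^{\times}$, $$1_S=\sum_{\chi}c_\chi\,\chi,\qquad c_\chi=\frac1{\varphi(m)}\sum_{a\in S}\overline{\chi}(a),$$ and call $\chi$ real if all its values are real, and complex otherwise. (i) If $c_\chi\ge 0$ for every real $\chi$ and $c_\chi=0$ for every complex $\chi$, then there is a constant $C>0$ such that, as $x\to\infty$, $$\mathbb{P}\Big(\sum_{n\in A,\ n<x}\frac{f(n)}{n}<0\Big)=O\left(\exp\left(-\exp\left(\frac{\ln x}{C\ln\ln x}\right)\right)\right).$$ (ii) Otherwise there is a constant $\delta>0$, independent of $x$, such that for all sufficiently large $x$ $$\mathbb{P}\Big(\sum_{n\in A,\ n<x}\frac{f(n)}{n}<0\Big)>\delta.$$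 -/

import Mathlib

open MeasureTheory ProbabilityTheory Filter Asymptotics

/-- `f` is a random completely multiplicative function with values `±1`: complete multiplicativity
of every sample `f ω` is built into the type `ℕ →*₀ ℝ`, and the values `f ω p` at the primes `p` are
independent random variables, each equal to `1` or `-1` with probability `1 / 2`. -/
structure IsRandomCompletelyMultiplicative {Ω : Type*} [MeasurableSpace Ω] (P : Measure Ω)
    (f : Ω → (ℕ →*₀ ℝ)) : Prop where
  measurable_prime : ∀ p : Nat.Primes, Measurable fun ω => f ω (p : ℕ)
  prob_one : ∀ p : Nat.Primes, P {ω | f ω (p : ℕ) = 1} = 1 / 2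
  prob_neg_one : ∀ p : Nat.Primes, P {ω | f ω (p : ℕ) = -1} = 1 / 2
  indep : iIndepFun (fun (p : Nat.Primes) (ω : Ω) => f ω (p : ℕ)) P

/-- The natural numbers lying in one of the residue classes modulo `m` that belong to `S`. -/
def residueSet (m : ℕ) (S : Finset (ZMod m)ˣ) : Set ℕ :=
  {n | ∃ a ∈ S, (n : ZMod m) = (a : ZMod m)}

open Classical in
/-- The sum of `g n / n` over the elements `n` of `residueSet m S` with `1 ≤ n < x`. -/
noncomputable def residuePartialSum (m : ℕ) (S : Finset (ZMod m)ˣ) (g : ℕ → ℝ) (x : ℝ) : ℝ :=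
  ∑ n ∈ Finset.Ico 1 ⌈x⌉₊ with n ∈ residueSet m S, g n / (n : ℝ)

/-- The coefficient of the character `χ` in the expansion of the characteristic function of `S`
into characters of `(ℤ/mℤ)ˣ`; see `sum_charCoeff_mul` for the expansion. -/
noncomputable def charCoeff (m : ℕ) (S : Finset (ZMod m)ˣ) (χ : DirichletCharacter ℂ m) : ℂ :=
  (1 / (Nat.totient m : ℂ)) * ∑ a ∈ S, (starRingEnd ℂ) (χ (a : ZMod m))

/-- A character is real if all its values are real; the other characters are called complex. -/
def IsRealCharacter (m : ℕ) (χ : DirichletCharacter ℂ m) : Prop :=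
  ∀ a : ZMod m, (χ a).im = 0

/-- In the expansion of the characteristic function of `S`, the (automatically real) coefficients
of the real characters are non-negative and the coefficients of the complex characters vanish. -/
def HasNonnegRealExpansion (m : ℕ) (S : Finset (ZMod m)ˣ) : Prop :=
  (∀ χ : DirichletCharacter ℂ m, IsRealCharacter m χ → 0 ≤ (charCoeff m S χ).re) ∧
  (∀ χ : DirichletCharacter ℂ m, ¬ IsRealCharacter m χ → charCoeff m S χ = 0)

open Classical in
/-- The expansion of the characteristic function of `S` whose coefficients are `charCoeff m S`. -/
theorem sum_charCoeff_mul (m : ℕ) [NeZero m] (S : Finset (ZMod m)ˣ) (b : (ZMod m)ˣ) :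
    ∑ χ : DirichletCharacter ℂ m, charCoeff m S χ * χ (b : ZMod m) = if b ∈ S then 1 else 0 := by
  have key : ∀ a : (ZMod m)ˣ,
      ∑ χ : DirichletCharacter ℂ m, (starRingEnd ℂ) (χ (a : ZMod m)) * χ (b : ZMod m)
        = if a = b then (Nat.totient m : ℂ) else 0 := by
    intro a
    have h := DirichletCharacter.sum_char_inv_mul_char_eq ℂ a.isUnit (b : ZMod m)
    simp only [Units.val_inj] at h
    rw [← h]
    refine Finset.sum_congr rfl fun χ _ => ?_
    congr 1
    rw [starRingEnd_apply, ← MulChar.star_apply, MulChar.star_eq_inv, MulChar.inv_apply,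
      Ring.inverse_unit, ZMod.inv_coe_unit]
  have hm : (Nat.totient m : ℂ) ≠ 0 := by
    exact_mod_cast (Nat.totient_pos.2 (Nat.pos_of_ne_zero (NeZero.ne m))).ne'
  simp only [charCoeff, mul_assoc, Finset.sum_mul]
  rw [← Finset.mul_sum, Finset.sum_comm]
  simp only [key, Finset.sum_ite_eq']
  split_ifs <;> simp [hm]

/-! Write c_χ for the character coefficients of S. The sum of f(n)/n over all N-smooth n in A is
exactly ∑_χ c_χ ∏_{p<N} (1 - χ(p)f(p)/p)⁻¹ (`eulerCombination`). Restricting it to n < x costs at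
most x^(-α) ∏_{p<N} (1 - p^(α-1))⁻¹ by Rankin's trick (`abs_smoothPartialSum_sub_le`). What is left,
the integers with a prime factor ≥ N, is controlled by the randomness of the signs at the primes ≥
N.

Nonnegative case. Every surviving Euler product is positive, and the trivial character alone
contributes a negative power of log N whatever the signs are (`eulerCombination_re_ge`). With N near
exp(log x / (57 log log x)) and α = 1/log N, the truncation error is smaller still, so the smooth
part is at least t, of order (log x)^(-28), for every choice of signs. Revealing the signs at the
primes p ≥ N in increasing order changes the sum by increments that are centred up to O(log x / p²)
and have size O(log x / p). An Azuma–Hoeffding argument (`measure_smoothPartialSum_sub_le_le`)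
bounds the probability of a drop by t by O(exp(-cN t²/(log x)²)), which is doubly exponentially
small.

Other case. The reciprocals of the primes diverge in every invertible class, so signs on an interval
of primes can steer the sums ∑ f(p)/p over the classes to any prescribed targets. Targets whose
Fourier transform lives on one bad character and its conjugate turn the corresponding terms into
large negative numbers and hardly move the others (`exists_signs_eulerCombination_re_le`). For a
fixed large N these signs form an event E of positive probability. On E the rough part has mean
square at most P(E) times a small constant, by orthogonality of f on squarefree rough integers
(`integral_indicator_mul_sq_le`), so Chebyshev's inequality keeps the sum negative on a fixed
proportion of E. -/

/-! ### Mertens-type bounds for primes. -/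

/-- A Mertens-type upper bound for the sum of the reciprocals of the primes below `N`. -/
theorem sum_inv_primesBelow_le {H : ℝ} (hH : 1 ≤ H) {N : ℕ} (hN : (N : ℝ) ≤ Real.exp H) :
    ∑ p ∈ N.primesBelow, (1 / (p : ℝ)) ≤ 4 * Real.log H + 8 := by
  -- Chebyshev's bound θ(y) ≤ y log 4, divided by the least value of p log p on [2^(k+1), 2^(k+2)),
  -- gives at most 4/(k+1) for that block.
  have dyadic : ∀ k : ℕ, ∑ p ∈ Nat.primesBelow (2 ^ (k + 1)), (1 / (p : ℝ))
      ≤ 4 * ((harmonic k : ℚ) : ℝ) := by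
    intro k
    induction k with
    | zero =>
      have : Nat.primesBelow (2 ^ (0 + 1)) = ∅ := by decide
      rw [this]; simp
    | succ k ih =>
      have hsub : Nat.primesBelow (2 ^ (k + 1)) ⊆ Nat.primesBelow (2 ^ (k + 1 + 1)) := by
        intro p hp
        rw [Nat.mem_primesBelow] at hp ⊢
        exact ⟨hp.1.trans (Nat.pow_lt_pow_right (by norm_num) (by omega)), hp.2⟩
      rw [← Finset.sum_sdiff hsub, harmonic_succ]
      push_cast
      have hlog2 : 0 < Real.log 2 := Real.log_pos (by norm_num)
      have hb : ∑ p ∈ Nat.primesBelow (2 ^ (k + 1 + 1)) \ Nat.primesBelow (2 ^ (k + 1)), (1 / (p : ℝ))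
          ≤ 4 * ((k : ℝ) + 1)⁻¹ := by
        have h1 : ∀ p ∈ Nat.primesBelow (2 ^ (k + 1 + 1)) \ Nat.primesBelow (2 ^ (k + 1)),
            (1 / (p : ℝ)) ≤ Real.log p / (2 ^ (k + 1) * ((k + 1) * Real.log 2)) := by
          intro p hp
          rw [Finset.mem_sdiff, Nat.mem_primesBelow, Nat.mem_primesBelow] at hp
          have hpge : 2 ^ (k + 1) ≤ p := by
            by_contra h
            exact hp.2 ⟨not_le.1 h, hp.1.2⟩
          have hpge' : (2 : ℝ) ^ (k + 1) ≤ p := by exact_mod_cast hpge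
          have hp0 : (0 : ℝ) < p := by exact_mod_cast hp.1.2.pos
          have hl : ((k : ℝ) + 1) * Real.log 2 ≤ Real.log p := by
            have := Real.log_le_log (by positivity) hpge'
            rw [Real.log_pow] at this
            push_cast at this
            exact this
          rw [div_le_div_iff₀ hp0 (by positivity)]
          rw [one_mul, mul_comm (Real.log p)]
          exact mul_le_mul hpge' hl (by positivity) hp0.le
        refine (Finset.sum_le_sum h1).trans ?_
        rw [← Finset.sum_div]
        have h2 : ∑ p ∈ Nat.primesBelow (2 ^ (k + 1 + 1)) \ Nat.primesBelow (2 ^ (k + 1)), Real.log p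
            ≤ Chebyshev.theta ((2 ^ (k + 1 + 1) : ℕ) : ℝ) := by
          rw [Chebyshev.theta_eq_sum_primesLE_log]
          refine Finset.sum_le_sum_of_subset_of_nonneg ?_ ?_
          · intro p hp
            rw [Finset.mem_sdiff, Nat.mem_primesBelow] at hp
            rw [Nat.mem_primesLE]
            exact ⟨hp.1.1.le, hp.1.2⟩
          · intro p hp _
            exact Real.log_natCast_nonneg p
        have h3 := Chebyshev.theta_le_log4_mul_x (x := ((2 ^ (k + 1 + 1) : ℕ) : ℝ)) (by positivity)
        have h4 : Real.log 4 = 2 * Real.log 2 := by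
          rw [show (4 : ℝ) = 2 ^ 2 by norm_num, Real.log_pow]; norm_num
        rw [div_le_iff₀ (by positivity)]
        refine (h2.trans h3).trans (le_of_eq ?_)
        rw [h4]
        push_cast
        field_simp
        ring
      linarith
  -- Since log 2 > 1/2 and k + 1 > 2H, the power 2^(k+1) exceeds exp H.
  set k := ⌊2 * H⌋₊ with hk
  have hk1 : 2 * H < k + 1 := Nat.lt_floor_add_one _
  have hk2 : (k : ℝ) ≤ 2 * H := Nat.floor_le (by linarith)
  have hlog2 : (1 / 2 : ℝ) < Real.log 2 := by linarith [Real.log_two_gt_d9]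
  have hNk : N ≤ 2 ^ (k + 1) := by
    have : (N : ℝ) ≤ 2 ^ (k + 1) := by
      refine hN.trans ?_
      rw [← Real.exp_log (show (0 : ℝ) < 2 by norm_num), ← Real.exp_nat_mul]
      refine Real.exp_le_exp.2 ?_
      push_cast
      nlinarith
    exact_mod_cast this
  have hkpos : (0 : ℝ) < k := by linarith
  have hsub : N.primesBelow ⊆ Nat.primesBelow (2 ^ (k + 1)) := by
    intro p hp
    rw [Nat.mem_primesBelow] at hp ⊢
    exact ⟨hp.1.trans_le hNk, hp.2⟩
  have h1 := Finset.sum_le_sum_of_subset_of_nonneg (f := fun p : ℕ => 1 / (p : ℝ)) hsub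
    (fun _ _ _ => by positivity)
  have h2 := dyadic k
  have h3 := harmonic_le_one_add_log k
  have h4 : Real.log k ≤ Real.log 2 + Real.log H := by
    rw [← Real.log_mul (by norm_num) (by linarith)]
    exact Real.log_le_log hkpos hk2
  have h5 : Real.log 2 ≤ 1 := by linarith [Real.log_two_lt_d9]
  linarith

/-- A Mertens-type upper bound for Euler products of the zeta function near `1`. -/
theorem prod_primesBelow_one_sub_rpow_inv_le {H α : ℝ} (hH : 1 ≤ H) {N : ℕ}
    (hN : (N : ℝ) ≤ Real.exp H) (hα0 : 0 ≤ α) (hα : α ≤ 1 / 4) (hαH : α * H ≤ 1) :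
    ∏ p ∈ N.primesBelow, (1 - (p : ℝ) ^ (α - 1))⁻¹ ≤ Real.exp 56 * H ^ 28 := by
  -- Here p^α ≤ e because α log p ≤ αH ≤ 1, and (1 - z)⁻¹ ≤ 1 + 5z/2 for z ≤ 3/5; the 7 rounds up
  -- 2.72 · 5/2. Against the bound 4 log H + 8 it yields the constants 28 and 56.
  have hfac : ∀ p ∈ N.primesBelow, (1 - (p : ℝ) ^ (α - 1))⁻¹ ≤ Real.exp (7 * (1 / p)) := by
    intro p hp
    rw [Nat.mem_primesBelow] at hp
    have hp0 : (0 : ℝ) < p := by exact_mod_cast hp.2.pos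
    have hp2 : (2 : ℝ) ≤ p := by exact_mod_cast hp.2.two_le
    set z := (p : ℝ) ^ (α - 1) with hz
    have hz0 : 0 < z := by positivity
    have hz1 : z ≤ 3 / 5 := by
      have h1 : z ≤ (2 : ℝ) ^ (-(3 / 4) : ℝ) :=
        (Real.rpow_le_rpow_of_nonpos (by norm_num) hp2 (by linarith)).trans
          (Real.rpow_le_rpow_of_exponent_le (by norm_num) (by linarith))
      have h2 : (2 : ℝ) ^ (-(3 / 4) : ℝ) ≤ 3 / 5 := by
        rw [← pow_le_pow_iff_left₀ (by positivity) (by norm_num) (show (4 : ℕ) ≠ 0 by norm_num),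
          ← Real.rpow_natCast, ← Real.rpow_mul (by norm_num)]
        norm_num
      exact h1.trans h2
    have hz2 : z ≤ 2.72 * (1 / p) := by
      rw [hz, Real.rpow_sub hp0, Real.rpow_one, div_eq_mul_one_div]
      refine mul_le_mul_of_nonneg_right ?_ (by positivity)
      have : (p : ℝ) ^ α ≤ Real.exp 1 := by
        rw [Real.rpow_def_of_pos hp0]
        refine Real.exp_le_exp.2 ?_
        have : Real.log p ≤ H := by
          rw [Real.log_le_iff_le_exp hp0]
          exact le_trans (by exact_mod_cast hp.1.le) hN
        nlinarith
      linarith [Real.exp_one_lt_d9]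
    have h3 : 1 - z ≥ 2 / 5 := by linarith
    have h4 : (1 - z)⁻¹ ≤ 1 + 5 / 2 * z := by
      rw [inv_le_iff_one_le_mul₀ (by linarith)]
      nlinarith
    have h5 := Real.add_one_le_exp (5 / 2 * z)
    refine (h4.trans (by linarith)).trans (Real.exp_le_exp.2 (?_ : 5 / 2 * z ≤ _))
    have : 0 < 1 / (p : ℝ) := by positivity
    linarith
  have hnn : ∀ p ∈ N.primesBelow, 0 ≤ (1 - (p : ℝ) ^ (α - 1))⁻¹ := by
    intro p hp
    rw [Nat.mem_primesBelow] at hp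
    refine inv_nonneg.2 (sub_nonneg.2 (Real.rpow_le_one_of_one_le_of_nonpos ?_ (by linarith)))
    exact_mod_cast hp.2.one_lt.le
  refine (Finset.prod_le_prod hnn hfac).trans ?_
  rw [← Real.exp_sum, ← Finset.mul_sum]
  have := sum_inv_primesBelow_le hH hN
  have hHe : H ^ 28 = Real.exp (28 * Real.log H) := by
    rw [mul_comm, Real.exp_mul, Real.exp_log (by linarith)]
    norm_cast
  rw [hHe, ← Real.exp_add]
  exact Real.exp_le_exp.2 (by linarith)

/-! ### Divergence of prime reciprocals in a residue class. -/

open ArithmeticFunction.vonMangoldt in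
/-- The sum of the reciprocals of the primes in an invertible residue class diverges. -/
theorem not_summable_one_div_primes_residueClass {q : ℕ} [NeZero q] {a : ZMod q} (ha : IsUnit a) :
    ¬ Summable fun n : ℕ => if n.Prime ∧ (n : ZMod q) = a then 1 / (n : ℝ) else 0 := by
  intro hsum
  obtain ⟨C, hC⟩ := LSeries_residueClass_lower_bound ha
  have hnp := summable_residueClass_non_primes_div a
  set K := ∑' n : ℕ, (if n.Prime then 0 else residueClass a n) / (n : ℝ) with hK
  -- This is δ times the prime part of the von Mangoldt series at 1 + δ. Since u e^(-u) ≤ 1 it is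
  -- dominated by 1/n, so convergence of ∑ 1/p would force its sum to 0 as δ → 0, whereas the pole
  -- at 1 keeps it near 1/φ(q); the prime powers contribute only O(δ).
  let F : ℝ → ℕ → ℝ := fun δ n =>
    if n.Prime ∧ (n : ZMod q) = a then δ * Real.log n * (n : ℝ) ^ (-δ) / n else 0
  have hF0 : ∀ δ > 0, ∀ n, 0 ≤ F δ n := by
    intro δ hδ n
    simp only [F]
    split_ifs
    · have := Real.log_natCast_nonneg n
      positivity
    · exact le_rfl
  have hFle : ∀ δ > 0, ∀ n, F δ n ≤ if n.Prime ∧ (n : ZMod q) = a then 1 / (n : ℝ) else 0 := by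
    intro δ hδ n
    simp only [F]
    split_ifs with h
    · have hn : (0 : ℝ) < n := by exact_mod_cast h.1.pos
      refine div_le_div_of_nonneg_right ?_ hn.le
      rw [Real.rpow_def_of_pos hn, show Real.log n * -δ = -(δ * Real.log n) by ring, Real.exp_neg,
        ← div_eq_mul_inv, div_le_one (Real.exp_pos _)]
      linarith [Real.add_one_le_exp (δ * Real.log n)]
    · exact le_rfl
  have hFlim : ∀ n, Tendsto (fun δ => F δ n) (nhdsWithin 0 (Set.Ioi 0)) (nhds 0) := by
    intro n
    simp only [F]
    split_ifs with h
    · have hn : (0 : ℝ) < n := by exact_mod_cast h.1.pos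
      have hc : Continuous fun δ : ℝ => δ * Real.log n * (n : ℝ) ^ (-δ) / n := by
        have : Continuous fun δ : ℝ => (n : ℝ) ^ (-δ) :=
          Continuous.rpow continuous_const continuous_neg (fun _ => Or.inl hn.ne')
        fun_prop
      have := (hc.tendsto 0).mono_left (nhdsWithin_le_nhds (s := Set.Ioi 0))
      simpa using this
    · exact tendsto_const_nhds
  have hlim : Tendsto (fun δ => ∑' n, F δ n) (nhdsWithin 0 (Set.Ioi 0)) (nhds 0) := by
    have := tendsto_tsum_of_dominated_convergence (𝓕 := nhdsWithin (0 : ℝ) (Set.Ioi 0))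
      (f := F) (g := fun _ => (0 : ℝ)) hsum hFlim (by
        filter_upwards [self_mem_nhdsWithin] with δ hδ n
        rw [Real.norm_of_nonneg (hF0 δ hδ n)]
        exact hFle δ hδ n)
    simpa using this
  have hineq : ∀ᶠ δ in nhdsWithin (0 : ℝ) (Set.Ioi 0),
      (q.totient : ℝ)⁻¹ ≤ ∑' n, F δ n + δ * (K + C) := by
    filter_upwards [Ioo_mem_nhdsGT (show (0 : ℝ) < 1 by norm_num)] with δ hδ
    have hδ0 : 0 < δ := hδ.1
    have h1 := @hC (1 + δ) ⟨by linarith, by linarith [hδ.2]⟩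
    have hsF : Summable (F δ) := Summable.of_nonneg_of_le (hF0 δ hδ0) (hFle δ hδ0) hsum
    have hle : ∀ n : ℕ, residueClass a n / (n : ℝ) ^ (1 + δ)
        ≤ δ⁻¹ * F δ n + (if n.Prime then 0 else residueClass a n) / (n : ℝ) := by
      intro n
      rcases Nat.eq_zero_or_pos n with rfl | hn
      · simp [F]
      have hn0 : (0 : ℝ) < n := by exact_mod_cast hn
      by_cases hp : n.Prime
      · simp only [hp, if_true, zero_div, add_zero, F, true_and]
        split_ifs with hc
        · have : residueClass a n = Real.log n := by
            simp [residueClass, hc, ArithmeticFunction.vonMangoldt_apply_prime hp]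
          rw [this, Real.rpow_add hn0, Real.rpow_one, Real.rpow_neg hn0.le]
          have : (0 : ℝ) < (n : ℝ) ^ δ := by positivity
          apply le_of_eq
          field_simp
        · simp [residueClass, hc]
      · simp only [hp, if_false]
        have h0 := residueClass_nonneg a n
        have h2 : residueClass a n / (n : ℝ) ^ (1 + δ) ≤ residueClass a n / n := by
          refine div_le_div_of_nonneg_left h0 hn0 ?_
          calc (n : ℝ) = (n : ℝ) ^ (1 : ℝ) := (Real.rpow_one _).symm
            _ ≤ _ := Real.rpow_le_rpow_of_exponent_le (by exact_mod_cast hn) (by linarith)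
        have h3 : 0 ≤ δ⁻¹ * F δ n := mul_nonneg (by positivity) (hF0 δ hδ0 n)
        linarith
    have hsR : Summable fun n : ℕ =>
        δ⁻¹ * F δ n + (if n.Prime then 0 else residueClass a n) / (n : ℝ) :=
      (hsF.mul_left _).add hnp
    have hsL : Summable fun n : ℕ => residueClass a n / (n : ℝ) ^ (1 + δ) :=
      Summable.of_nonneg_of_le
        (fun n => div_nonneg (residueClass_nonneg a n) (by positivity)) hle hsR
    have h2 := hsL.tsum_le_tsum hle hsR
    rw [(hsF.mul_left _).tsum_add hnp, tsum_mul_left, ← hK] at h2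
    have h3 := h1.trans h2
    rw [show 1 + δ - 1 = δ by ring] at h3
    have h4 := mul_le_mul_of_nonneg_left h3 hδ0.le
    have e1 : δ * ((q.totient : ℝ)⁻¹ / δ - C) = (q.totient : ℝ)⁻¹ - δ * C := by field_simp
    have e2 : δ * (δ⁻¹ * ∑' n, F δ n + K) = ∑' n, F δ n + δ * K := by field_simp
    rw [e1, e2] at h4
    linarith
  have hlim2 : Tendsto (fun δ => ∑' n, F δ n + δ * (K + C)) (nhdsWithin 0 (Set.Ioi 0))
      (nhds (0 + 0 * (K + C))) :=
    hlim.add (((tendsto_id (α := ℝ)).mono_left nhdsWithin_le_nhds).mul_const _)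
  have := ge_of_tendsto hlim2 hineq
  have hpos : (0 : ℝ) < (q.totient : ℝ)⁻¹ :=
    inv_pos.2 (by exact_mod_cast Nat.totient_pos.2 (Nat.pos_of_ne_zero (NeZero.ne q)))
  linarith

/-! ### Sums over smooth numbers and the effect of adding one prime. -/

theorem Finset.sum_le_sum_of_injOn_of_nonneg {ι κ : Type*} {s : Finset ι} {t : Finset κ}
    {f : ι → ℝ} {g : κ → ℝ} (i : ι → κ) (hi : Set.InjOn i s) (hmem : ∀ a ∈ s, i a ∈ t)
    (hle : ∀ a ∈ s, f a ≤ g (i a)) (hg : ∀ b ∈ t, 0 ≤ g b) :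
    ∑ a ∈ s, f a ≤ ∑ b ∈ t, g b := by
  classical
  refine (Finset.sum_le_sum hle).trans ?_
  rw [← Finset.sum_image (f := g) hi]
  exact Finset.sum_le_sum_of_subset_of_nonneg (Finset.image_subset_iff.2 hmem)
    fun b hb _ => hg b hb

open Classical in
/-- The sum of `g n / n` over the `N`-smooth elements `n` of `A` with `1 ≤ n < X`. -/
noncomputable def smoothPartialSum (A : Set ℕ) (g : ℕ → ℝ) (X N : ℕ) : ℝ :=
  ∑ n ∈ Finset.Ico 1 X with n ∈ A ∧ n ∈ Nat.smoothNumbers N, g n / (n : ℝ)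

/-- Integers below ⌈x⌉₊ are automatically `K`-smooth. The level `K` is left free so that it can also
be taken above a given smoothness level `N`. -/
theorem residuePartialSum_eq_smoothPartialSum (m : ℕ) (S : Finset (ZMod m)ˣ) (g : ℕ → ℝ) (x : ℝ)
    {K : ℕ} (hK : ⌈x⌉₊ ≤ K) :
    residuePartialSum m S g x = smoothPartialSum (residueSet m S) g ⌈x⌉₊ K := by
  classical
  unfold residuePartialSum smoothPartialSum
  refine Finset.sum_congr (Finset.filter_congr fun n hn => ?_) fun _ _ => rfl
  rw [Finset.mem_Ico] at hn
  exact ⟨fun h => ⟨h, Nat.mem_smoothNumbers_of_lt (by omega) (by omega)⟩, fun h => h.1⟩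

theorem smoothPartialSum_succ_of_not_prime (A : Set ℕ) (g : ℕ → ℝ) (X : ℕ) {N : ℕ}
    (hN : ¬ N.Prime) : smoothPartialSum A g X (N + 1) = smoothPartialSum A g X N := by
  classical
  unfold smoothPartialSum
  refine Finset.sum_congr (Finset.filter_congr fun n _ => ?_) fun _ _ => rfl
  rw [Nat.smoothNumbers_succ hN]

open Classical in
/-- The coefficient of `g p` in the part of `smoothPartialSum A g X (p + 1)` that comes from the
integers exactly divisible by `p`. -/
noncomputable def smoothCofactorSum (A : Set ℕ) (g : ℕ → ℝ) (X p : ℕ) : ℝ :=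
  ∑ k ∈ Finset.Ico 1 X with p * k < X ∧ p * k ∈ A ∧ k ∈ Nat.smoothNumbers p,
    g k / ((p : ℝ) * k)

open Classical in
/-- The part of `smoothPartialSum A g X (p + 1)` that comes from the multiples of `p ^ 2`. -/
noncomputable def smoothSquareSum (A : Set ℕ) (g : ℕ → ℝ) (X p : ℕ) : ℝ :=
  ∑ n ∈ Finset.Ico 1 X with (n ∈ A ∧ n ∈ Nat.smoothNumbers (p + 1)) ∧ p ^ 2 ∣ n, g n / (n : ℝ)

theorem mem_smoothNumbers_succ_of_not_dvd {p n : ℕ} (hn : n ∈ Nat.smoothNumbers (p + 1))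
    (h : ¬ p ∣ n) : n ∈ Nat.smoothNumbers p := by
  rw [Nat.mem_smoothNumbers'] at hn ⊢
  intro q hq hqn
  refine lt_of_le_of_ne (Nat.lt_succ_iff.1 (hn q hq hqn)) ?_
  rintro rfl
  exact h hqn

/-- The integers are sorted by their exponent of p: 0, 1, or at least 2. The first sum and the
cofactor involve only primes below p, so the middle term is a martingale difference; the last is
merely small, of order 1/p². -/
theorem smoothPartialSum_succ_of_prime (A : Set ℕ) (g : ℕ →*₀ ℝ) (X : ℕ) {p : ℕ}
    (hp : p.Prime) :
    smoothPartialSum A g X (p + 1) = smoothPartialSum A g X p + g p * smoothCofactorSum A g X p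
      + smoothSquareSum A g X p := by
  classical
  have hnd : ∀ k ∈ Nat.smoothNumbers p, ¬ p ∣ k := fun k hk =>
    hp.coprime_iff_not_dvd.1 (hp.smoothNumbers_coprime hk)
  unfold smoothPartialSum smoothSquareSum
  rw [← Finset.sum_filter_add_sum_filter_not (Finset.filter _ _) (fun n => p ^ 2 ∣ n),
    ← Finset.sum_filter_add_sum_filter_not
      (Finset.filter (fun n => ¬ p ^ 2 ∣ n) _) (fun n => ¬ p ∣ n)]
  simp only [Finset.filter_filter]
  rw [add_comm]
  congr 1
  congr 1
  · refine Finset.sum_congr (Finset.filter_congr fun n hn => ?_) fun _ _ => rfl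
    constructor
    · rintro ⟨⟨⟨h1, h2⟩, -⟩, h3⟩
      exact ⟨h1, mem_smoothNumbers_succ_of_not_dvd h2 h3⟩
    · rintro ⟨h1, h2⟩
      refine ⟨⟨⟨h1, Nat.smoothNumbers_mono (Nat.le_succ p) h2⟩, fun h => ?_⟩, hnd n h2⟩
      exact hnd n h2 ((dvd_pow_self p two_ne_zero).trans h)
  · unfold smoothCofactorSum
    rw [Finset.mul_sum]
    symm
    refine Finset.sum_bij (fun k _ => p * k) ?_ ?_ ?_ ?_
    · intro k hk
      simp only [Finset.mem_filter, Finset.mem_Ico] at hk ⊢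
      obtain ⟨⟨hk1, hk2⟩, hk3, hk4, hk5⟩ := hk
      refine ⟨⟨Nat.mul_pos hp.pos hk1, hk3⟩, ⟨⟨hk4, ?_⟩, ?_⟩, ?_⟩
      · have := Nat.pow_mul_mem_smoothNumbers hp.ne_zero 1 hk5
        rwa [pow_one] at this
      · rw [pow_two]
        intro h
        exact hnd k hk5 (Nat.dvd_of_mul_dvd_mul_left hp.pos h)
      · exact not_not.2 (dvd_mul_right p k)
    · intro a _ b _ h
      exact Nat.eq_of_mul_eq_mul_left hp.pos h
    · intro n hn
      simp only [Finset.mem_filter, Finset.mem_Ico] at hn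
      obtain ⟨⟨hn1, hn2⟩, ⟨⟨hn3, hn4⟩, hn5⟩, hn6⟩ := hn
      obtain ⟨k, rfl⟩ := not_not.1 hn6
      have hk0 : 0 < k := Nat.pos_of_mul_pos_left hn1
      have hkX : k < X := lt_of_le_of_lt (Nat.le_mul_of_pos_left k hp.pos) hn2
      refine ⟨k, ?_, rfl⟩
      simp only [Finset.mem_filter, Finset.mem_Ico]
      refine ⟨⟨hk0, hkX⟩, hn2, hn3, mem_smoothNumbers_succ_of_not_dvd
        (Nat.mem_smoothNumbers_of_dvd hn4 (dvd_mul_left k p)) fun h => hn5 ?_⟩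
      rw [pow_two]
      exact Nat.mul_dvd_mul_left p h
    · intro k _
      rw [map_mul]
      push_cast
      ring

theorem abs_smoothCofactorSum_le (A : Set ℕ) {g : ℕ → ℝ} (hg : ∀ n, |g n| ≤ 1) (X p : ℕ) :
    |smoothCofactorSum A g X p| ≤ (∑ n ∈ Finset.Ico 1 X, 1 / (n : ℝ)) / p := by
  classical
  unfold smoothCofactorSum
  refine (Finset.abs_sum_le_sum_abs _ _).trans ?_
  rw [Finset.sum_div]
  refine (Finset.sum_le_sum (g := fun n : ℕ => 1 / (n : ℝ) / p) fun n _ => ?_).trans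
    (Finset.sum_le_sum_of_subset_of_nonneg (Finset.filter_subset _ _) fun _ _ _ => by positivity)
  rw [abs_div, abs_of_nonneg (by positivity : (0 : ℝ) ≤ (p : ℝ) * n), div_div, mul_comm (p : ℝ)]
  exact div_le_div_of_nonneg_right (hg n) (by positivity)

theorem abs_smoothSquareSum_le (A : Set ℕ) {g : ℕ → ℝ} (hg : ∀ n, |g n| ≤ 1) (X : ℕ) {p : ℕ}
    (hp : 0 < p) :
    |smoothSquareSum A g X p| ≤ (∑ n ∈ Finset.Ico 1 X, 1 / (n : ℝ)) / (p : ℝ) ^ 2 := by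
  classical
  unfold smoothSquareSum
  refine (Finset.abs_sum_le_sum_abs _ _).trans ?_
  rw [Finset.sum_div]
  have hpp : 0 < p ^ 2 := pow_pos hp 2
  refine Finset.sum_le_sum_of_injOn_of_nonneg (fun n => n / p ^ 2) ?_ ?_ ?_
    fun _ _ => by positivity
  · intro a ha b hb h
    simp only [Finset.coe_filter, Set.mem_ofPred_eq] at ha hb
    rw [← Nat.div_mul_cancel ha.2.2, ← Nat.div_mul_cancel hb.2.2]
    exact congrArg (· * p ^ 2) h
  · intro n hn
    simp only [Finset.mem_filter, Finset.mem_Ico] at hn ⊢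
    exact ⟨Nat.div_pos (Nat.le_of_dvd hn.1.1 hn.2.2) hpp,
      (Nat.div_le_self _ _).trans_lt hn.1.2⟩
  · intro n hn
    simp only [Finset.mem_filter, Finset.mem_Ico] at hn
    obtain ⟨k, rfl⟩ := hn.2.2
    rw [Nat.mul_div_cancel_left _ hpp, div_div, abs_div, Nat.abs_cast]
    push_cast
    rw [mul_comm (k : ℝ)]
    exact div_le_div_of_nonneg_right (hg _) (by positivity)

/-! ### Euler products and Rankin's truncation. -/

/-- A multiplicative function given by a Dirichlet character, a multiplicative `g` and `1 / n`. -/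
noncomputable def twistedInv {m : ℕ} (χ : DirichletCharacter ℂ m) (g : ℕ →*₀ ℝ) : ℕ →* ℂ where
  toFun n := χ n * (g n : ℂ) / n
  map_one' := by simp
  map_mul' a b := by
    push_cast [map_mul]
    rw [mul_mul_mul_comm, mul_div_mul_comm]

theorem hasSum_indicator_smoothNumbers_twistedInv {m : ℕ} (χ : DirichletCharacter ℂ m)
    (g : ℕ →*₀ ℝ) (hg : ∀ n, |g n| ≤ 1) (N : ℕ) :
    HasSum ((Nat.smoothNumbers N).indicator fun n => χ n * (g n : ℂ) / n)
      (∏ p ∈ N.primesBelow, (1 - χ p * (g p : ℂ) / p)⁻¹) := by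
  have h : ∀ {p : ℕ}, p.Prime → ‖twistedInv χ g p‖ < 1 := by
    intro p hp
    have h1 : ‖twistedInv χ g p‖ ≤ 1 / p := by
      change ‖χ p * (g p : ℂ) / p‖ ≤ _
      rw [norm_div, norm_mul, Complex.norm_real, Real.norm_eq_abs, Complex.norm_natCast]
      exact div_le_div_of_nonneg_right
        (mul_le_one₀ (χ.norm_le_one _) (abs_nonneg _) (hg p)) (by positivity)
    refine h1.trans_lt ?_
    rw [div_lt_one (by exact_mod_cast hp.pos)]
    exact_mod_cast hp.one_lt
  exact (hasSum_subtype_iff_indicator).1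
    (EulerProduct.summable_and_hasSum_smoothNumbers_prod_primesBelow_geometric h N).2

theorem hasSum_indicator_smoothNumbers_rpow {α : ℝ} (hα : α < 1) (N : ℕ) :
    HasSum ((Nat.smoothNumbers N).indicator fun n => (n : ℝ) ^ (α - 1))
      (∏ p ∈ N.primesBelow, (1 - (p : ℝ) ^ (α - 1))⁻¹) := by
  let F : ℕ →* ℝ :=
    { toFun := fun n => (n : ℝ) ^ (α - 1)
      map_one' := by simp
      map_mul' := fun a b => by
        push_cast
        exact Real.mul_rpow (by positivity) (by positivity) }
  have h : ∀ {p : ℕ}, p.Prime → ‖F p‖ < 1 := by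
    intro p hp
    change ‖(p : ℝ) ^ (α - 1)‖ < 1
    rw [Real.norm_of_nonneg (by positivity)]
    exact Real.rpow_lt_one_of_one_lt_of_neg (by exact_mod_cast hp.one_lt) (by linarith)
  exact (hasSum_subtype_iff_indicator).1
    (EulerProduct.summable_and_hasSum_smoothNumbers_prod_primesBelow_geometric h N).2

/-- The sum over the smooth numbers as a combination of Euler products. -/
noncomputable def eulerCombination (m : ℕ) [NeZero m] (S : Finset (ZMod m)ˣ) (g : ℕ → ℝ)
    (N : ℕ) : ℂ :=
  ∑ χ : DirichletCharacter ℂ m,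
    charCoeff m S χ * ∏ p ∈ N.primesBelow, (1 - χ p * (g p : ℂ) / p)⁻¹

open Classical in
theorem sum_charCoeff_mul_natCast (m : ℕ) [NeZero m] (S : Finset (ZMod m)ˣ) (n : ℕ) :
    ∑ χ : DirichletCharacter ℂ m, charCoeff m S χ * χ n = if n ∈ residueSet m S then 1 else 0 := by
  by_cases hn : IsUnit (n : ZMod m)
  · obtain ⟨b, hb⟩ := hn
    rw [← hb, sum_charCoeff_mul]
    have : (b ∈ S) ↔ n ∈ residueSet m S := by
      constructor
      · intro h
        exact ⟨b, h, hb.symm⟩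
      · rintro ⟨a, ha, h⟩
        rw [← hb] at h
        rwa [Units.ext h]
    simp only [this]
  · have h1 : n ∉ residueSet m S := by
      rintro ⟨a, -, h⟩
      exact hn (h ▸ a.isUnit)
    rw [if_neg h1]
    refine Finset.sum_eq_zero fun χ _ => ?_
    rw [χ.map_nonunit hn, mul_zero]

theorem hasSum_indicator_residueSet_inter_smoothNumbers (m : ℕ) [NeZero m]
    (S : Finset (ZMod m)ˣ) (g : ℕ →*₀ ℝ) (hg : ∀ n, |g n| ≤ 1) (N : ℕ) :
    HasSum ((residueSet m S ∩ Nat.smoothNumbers N).indicator fun n => g n / (n : ℝ))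
      (eulerCombination m S g N).re := by
  classical
  have h : HasSum (fun n : ℕ => ∑ χ : DirichletCharacter ℂ m, charCoeff m S χ *
      (Nat.smoothNumbers N).indicator (fun n => χ n * (g n : ℂ) / n) n)
      (eulerCombination m S g N) :=
    hasSum_sum fun χ _ => (hasSum_indicator_smoothNumbers_twistedInv χ g hg N).mul_left _
  have hfun : (residueSet m S ∩ Nat.smoothNumbers N).indicator (fun n => g n / (n : ℝ)) =
      fun n : ℕ => (∑ χ : DirichletCharacter ℂ m, charCoeff m S χ *
        (Nat.smoothNumbers N).indicator (fun n => χ n * (g n : ℂ) / n) n).re := by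
    funext n
    by_cases hn : n ∈ Nat.smoothNumbers N
    · simp only [Set.indicator_of_mem hn, mul_div_assoc, ← mul_assoc]
      rw [← Finset.sum_mul, sum_charCoeff_mul_natCast]
      by_cases hA : n ∈ residueSet m S
      · rw [Set.indicator_of_mem (Set.mem_inter hA hn), if_pos hA, one_mul]
        norm_cast
      · rw [Set.indicator_of_notMem fun h => hA h.1, if_neg hA, zero_mul, Complex.zero_re]
    · rw [Set.indicator_of_notMem fun h => hn h.2]
      simp [Set.indicator_of_notMem hn]
  rw [hfun]
  exact Complex.hasSum_re h

/-- Rankin's trick: a missing term has n ≥ X, hence 1/n ≤ X^(-α) n^(α-1), and the latter sums over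
all smooth n to an Euler product. -/
theorem abs_smoothPartialSum_sub_le {m : ℕ} [NeZero m] (S : Finset (ZMod m)ˣ) (g : ℕ →*₀ ℝ)
    (hg : ∀ n, |g n| ≤ 1) {X : ℕ} (hX : 0 < X) (N : ℕ) {α : ℝ} (hα0 : 0 ≤ α) (hα : α < 1) :
    |smoothPartialSum (residueSet m S) g X N - (eulerCombination m S g N).re|
      ≤ (X : ℝ) ^ (-α) * ∏ p ∈ N.primesBelow, (1 - (p : ℝ) ^ (α - 1))⁻¹ := by
  classical
  have h1 := hasSum_indicator_residueSet_inter_smoothNumbers m S g hg N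
  have h2 := (hasSum_indicator_smoothNumbers_rpow hα N).mul_left ((X : ℝ) ^ (-α))
  have h3 : HasSum (fun n => if n ∈ {n ∈ Finset.Ico 1 X | n ∈ residueSet m S ∧
      n ∈ Nat.smoothNumbers N} then g n / (n : ℝ) else 0)
      (smoothPartialSum (residueSet m S) g X N) := by
    unfold smoothPartialSum
    rw [← Finset.sum_congr rfl fun n hn => if_pos hn]
    exact hasSum_sum_of_ne_finset_zero fun n hn => if_neg hn
  have h4 := h3.sub h1
  rw [← Real.norm_eq_abs, ← h4.tsum_eq]
  refine tsum_of_norm_bounded h2 fun n => ?_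
  by_cases hn : n ∈ residueSet m S ∩ Nat.smoothNumbers N
  · rw [Set.indicator_of_mem hn, Set.indicator_of_mem hn.2]
    have hn0 : 0 < n := Nat.pos_of_ne_zero (Nat.ne_zero_of_mem_smoothNumbers hn.2)
    have hn0' : (0 : ℝ) < n := by exact_mod_cast hn0
    by_cases hnX : n < X
    · rw [if_pos (by simp only [Finset.mem_filter, Finset.mem_Ico]; exact ⟨⟨hn0, hnX⟩, hn⟩)]
      rw [sub_self, norm_zero]
      positivity
    · rw [if_neg (by simp only [Finset.mem_filter, Finset.mem_Ico]; tauto), zero_sub, norm_neg,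
        norm_div, Real.norm_eq_abs, Real.norm_natCast, Real.rpow_sub hn0', Real.rpow_one]
      rw [← mul_div_assoc]
      refine div_le_div_of_nonneg_right ((hg n).trans ?_) hn0'.le
      rw [Real.rpow_neg (by positivity), inv_mul_eq_div, one_le_div (by positivity)]
      exact Real.rpow_le_rpow (by positivity) (by exact_mod_cast not_lt.1 hnX) hα0
  · rw [Set.indicator_of_notMem hn, sub_zero,
      if_neg (by rw [Finset.mem_filter]; exact fun h => hn h.2), norm_zero]
    exact mul_nonneg (by positivity) (Set.indicator_nonneg (fun _ _ => by positivity) _)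

/-- For a real character each factor 1 - χ(p)g(p)/p is positive, so only the trivial character need
be kept. Its coefficient is |S|/φ(m) ≥ 1/φ(m), and each of its factors is at least (1 + 1/p)⁻¹ ≥ 1 -
1/p. -/
theorem eulerCombination_re_ge {m : ℕ} [NeZero m] {S : Finset (ZMod m)ˣ} (hS : S.Nonempty)
    (hSn : HasNonnegRealExpansion m S) {g : ℕ → ℝ} (hg : ∀ n, |g n| ≤ 1) (N : ℕ) :
    (1 / (m.totient : ℝ)) / ∏ p ∈ N.primesBelow, (1 - 1 / (p : ℝ))⁻¹
      ≤ (eulerCombination m S g N).re := by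
  classical
  have hprod : ∀ χ : DirichletCharacter ℂ m, IsRealCharacter m χ →
      ∏ p ∈ N.primesBelow, (1 - χ p * (g p : ℂ) / p)⁻¹ =
        ((∏ p ∈ N.primesBelow, (1 - (χ p).re * g p / p)⁻¹ : ℝ) : ℂ) := by
    intro χ hχ
    push_cast
    refine Finset.prod_congr rfl fun p _ => ?_
    rw [show χ (p : ZMod m) = ((χ (p : ZMod m)).re : ℂ) from Complex.ext rfl (by simpa using hχ p)]
    simp
  have hfac : ∀ χ : DirichletCharacter ℂ m, ∀ p ∈ N.primesBelow,
      0 < 1 - (χ p).re * g p / p ∧ 1 - (χ p).re * g p / p ≤ 1 + 1 / (p : ℝ) := by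
    intro χ p hp
    rw [Nat.mem_primesBelow] at hp
    have hp1 : (1 : ℝ) < p := by exact_mod_cast hp.2.one_lt
    have h1 : |(χ p).re * g p| ≤ 1 := by
      rw [abs_mul]
      exact mul_le_one₀ ((Complex.abs_re_le_norm _).trans (χ.norm_le_one _)) (abs_nonneg _) (hg p)
    rw [abs_le] at h1
    have h2 : (χ p).re * g p / p < 1 := by
      rw [div_lt_one (by linarith)]; linarith
    have h3 : -1 / (p : ℝ) ≤ (χ p).re * g p / p :=
      div_le_div_of_nonneg_right h1.1 (by linarith)
    constructor
    · linarith
    · rw [neg_div] at h3; linarith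
  have hterm : ∀ χ : DirichletCharacter ℂ m, 0 ≤ (charCoeff m S χ *
      ∏ p ∈ N.primesBelow, (1 - χ p * (g p : ℂ) / p)⁻¹).re := by
    intro χ
    by_cases hχ : IsRealCharacter m χ
    · rw [hprod χ hχ, Complex.re_mul_ofReal]
      exact mul_nonneg (hSn.1 χ hχ) (Finset.prod_nonneg fun p hp =>
        inv_nonneg.2 (hfac χ p hp).1.le)
    · rw [hSn.2 χ hχ, zero_mul, Complex.zero_re]
  unfold eulerCombination
  rw [Complex.re_sum]
  refine le_trans ?_ (Finset.single_le_sum (fun χ _ => hterm χ) (Finset.mem_univ 1))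
  have hreal : IsRealCharacter m (1 : DirichletCharacter ℂ m) := by
    intro a
    by_cases ha : IsUnit a
    · rw [MulChar.one_apply ha]; simp
    · rw [MulChar.map_nonunit _ ha]; simp
  rw [hprod 1 hreal, Complex.re_mul_ofReal]
  have hc : 1 / (m.totient : ℝ) ≤ (charCoeff m S 1).re := by
    have : charCoeff m S 1 = ((1 / (m.totient : ℝ) * S.card : ℝ) : ℂ) := by
      unfold charCoeff
      simp
    rw [this, Complex.ofReal_re]
    refine le_mul_of_one_le_right (by positivity) ?_
    exact_mod_cast hS.card_pos
  rw [div_eq_mul_inv, ← Finset.prod_inv_distrib]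
  refine mul_le_mul hc (Finset.prod_le_prod ?_ ?_) ?_ (le_trans (by positivity) hc)
  · intro p hp
    rw [Nat.mem_primesBelow] at hp
    have hp1 : (1 : ℝ) < p := by exact_mod_cast hp.2.one_lt
    rw [inv_inv, sub_nonneg, div_le_one (by linarith)]
    exact hp1.le
  · intro p hp
    obtain ⟨h1, h2⟩ := hfac 1 p hp
    rw [Nat.mem_primesBelow] at hp
    have hp1 : (1 : ℝ) < p := by exact_mod_cast hp.2.one_lt
    have hp2 : 0 < 1 / (p : ℝ) := by positivity
    rw [inv_inv]
    calc 1 - 1 / (p : ℝ) ≤ (1 + 1 / (p : ℝ))⁻¹ := by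
          rw [← one_div, le_div_iff₀ (by positivity)]
          nlinarith
      _ ≤ _ := inv_anti₀ h1 h2
  · refine Finset.prod_nonneg fun p hp => ?_
    rw [Nat.mem_primesBelow] at hp
    have hp1 : (1 : ℝ) < p := by exact_mod_cast hp.2.one_lt
    rw [inv_inv, sub_nonneg, div_le_one (by linarith)]
    exact hp1.le

/-! ### Measurability and independence of the signs. -/

/-- The `σ`-algebra generated by the values of `f` at the primes in `T`. -/
abbrev primesSigma {Ω : Type*} (f : Ω → (ℕ →*₀ ℝ)) (T : Set Nat.Primes) : MeasurableSpace Ω :=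
  ⨆ p ∈ T, MeasurableSpace.comap (fun ω => f ω (p : ℕ)) inferInstance

theorem primesSigma_mono {Ω : Type*} (f : Ω → (ℕ →*₀ ℝ)) {T U : Set Nat.Primes} (h : T ⊆ U) :
    primesSigma f T ≤ primesSigma f U :=
  biSup_mono h

theorem measurable_primesSigma {Ω : Type*} (f : Ω → (ℕ →*₀ ℝ)) (T : Set Nat.Primes) (n : ℕ)
    (hn : n ≠ 0) (h : ∀ p : Nat.Primes, (p : ℕ) ∣ n → p ∈ T) :
    Measurable[primesSigma f T] fun ω => f ω n := by
  induction n using induction_on_primes with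
  | zero => exact absurd rfl hn
  | one => simp only [map_one]; exact measurable_const
  | prime_mul p a hp ih =>
    simp only [map_mul]
    refine Measurable.mul ?_ (ih (right_ne_zero_of_mul hn) fun q hq => h q (hq.mul_left p))
    have h1 : MeasurableSpace.comap (fun ω => f ω p) inferInstance ≤ primesSigma f T :=
      le_biSup (fun p : Nat.Primes => MeasurableSpace.comap (fun ω => f ω (p : ℕ)) inferInstance)
        (h ⟨p, hp⟩ (dvd_mul_right p a))
    exact (comap_measurable _).mono h1 le_rfl

theorem measurable_smoothPartialSum {Ω : Type*} (f : Ω → (ℕ →*₀ ℝ)) (A : Set ℕ) (X N : ℕ) :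
    Measurable[primesSigma f {p | (p : ℕ) < N}] fun ω => smoothPartialSum A (f ω) X N := by
  classical
  unfold smoothPartialSum
  refine Finset.measurable_sum _ fun n hn => Measurable.div_const ?_ _
  rw [Finset.mem_filter] at hn
  exact measurable_primesSigma f _ n (Nat.ne_zero_of_mem_smoothNumbers hn.2.2) fun p hp =>
    Nat.mem_smoothNumbers'.1 hn.2.2 p p.2 hp

theorem measurable_smoothCofactorSum {Ω : Type*} (f : Ω → (ℕ →*₀ ℝ)) (A : Set ℕ) (X N : ℕ) :
    Measurable[primesSigma f {p | (p : ℕ) < N}] fun ω => smoothCofactorSum A (f ω) X N := by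
  classical
  unfold smoothCofactorSum
  refine Finset.measurable_sum _ fun n hn => Measurable.div_const ?_ _
  rw [Finset.mem_filter] at hn
  exact measurable_primesSigma f _ n (Nat.ne_zero_of_mem_smoothNumbers hn.2.2.2) fun p hp =>
    Nat.mem_smoothNumbers'.1 hn.2.2.2 p p.2 hp

theorem abs_smoothPartialSum_le (A : Set ℕ) {g : ℕ → ℝ} (hg : ∀ n, |g n| ≤ 1) (X N : ℕ) :
    |smoothPartialSum A g X N| ≤ ∑ n ∈ Finset.Ico 1 X, 1 / (n : ℝ) := by
  classical
  unfold smoothPartialSum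
  refine (Finset.abs_sum_le_sum_abs _ _).trans
    ((Finset.sum_le_sum (g := fun n : ℕ => 1 / (n : ℝ)) fun n _ => ?_).trans
    (Finset.sum_le_sum_of_subset_of_nonneg (Finset.filter_subset _ _) fun _ _ _ => by positivity))
  rw [abs_div, Nat.abs_cast]
  exact div_le_div_of_nonneg_right (hg n) (Nat.cast_nonneg n)

theorem sum_Ico_one_div_sq_le {N : ℕ} (hN : 0 < N) (K : ℕ) :
    ∑ j ∈ Finset.Ico N K, 1 / (j : ℝ) ^ 2 ≤ 2 / (N : ℝ) := by
  obtain ⟨k, rfl⟩ : ∃ k, N = k + 1 := ⟨N - 1, by omega⟩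
  have h := sum_Ioo_inv_sq_le (α := ℝ) k K
  have he : Finset.Ico (k + 1) K = Finset.Ioo k K := by
    ext; simp
  rw [he]
  simp only [one_div]
  push_cast
  exact h

theorem abs_eq_one_of_primes {g : ℕ →*₀ ℝ} (hg : ∀ p : ℕ, p.Prime → g p = 1 ∨ g p = -1) {n : ℕ}
    (hn : n ≠ 0) : |g n| = 1 := by
  induction n using induction_on_primes with
  | zero => exact absurd rfl hn
  | one => simp
  | prime_mul p a hp ih =>
    rw [map_mul, abs_mul, ih (right_ne_zero_of_mul hn), mul_one]
    rcases hg p hp with h | h <;> rw [h] <;> simp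

theorem abs_le_one_of_primes {g : ℕ →*₀ ℝ} (hg : ∀ p : ℕ, p.Prime → g p = 1 ∨ g p = -1) (n : ℕ) :
    |g n| ≤ 1 := by
  rcases eq_or_ne n 0 with rfl | hn
  · simp
  · exact (abs_eq_one_of_primes hg hn).le

namespace IsRandomCompletelyMultiplicative

variable {Ω : Type*} [MeasurableSpace Ω] {P : Measure Ω} {f : Ω → (ℕ →*₀ ℝ)}

theorem primesSigma_le (hf : IsRandomCompletelyMultiplicative P f) (T : Set Nat.Primes) :
    primesSigma f T ≤ (inferInstance : MeasurableSpace Ω) :=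
  iSup₂_le fun p _ => (hf.measurable_prime p).comap_le

theorem measurable_apply (hf : IsRandomCompletelyMultiplicative P f) {n : ℕ} (hn : n ≠ 0) :
    Measurable fun ω => f ω n :=
  (measurable_primesSigma f Set.univ n hn fun _ _ => Set.mem_univ _).mono
    (hf.primesSigma_le _) le_rfl

variable [IsProbabilityMeasure P]

theorem ae_eq_one_or_neg_one (hf : IsRandomCompletelyMultiplicative P f) :
    ∀ᵐ ω ∂P, ∀ p : ℕ, p.Prime → f ω p = 1 ∨ f ω p = -1 := by
  have h : ∀ p : Nat.Primes, ∀ᵐ ω ∂P, f ω (p : ℕ) = 1 ∨ f ω (p : ℕ) = -1 := by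
    intro p
    have hm : MeasurableSet {ω | f ω (p : ℕ) = -1} :=
      hf.measurable_prime p (measurableSet_singleton _)
    have hm1 : MeasurableSet {ω | f ω (p : ℕ) = 1} :=
      hf.measurable_prime p (measurableSet_singleton _)
    have hu := measure_union (μ := P) (s₁ := {ω | f ω (p : ℕ) = 1}) (s₂ := {ω | f ω (p : ℕ) = -1})
      (Set.disjoint_left.2 fun ω h1 h2 => by
        simp only [Set.mem_ofPred_eq] at h1 h2
        rw [h1] at h2
        norm_num at h2) hm
    rw [hf.prob_one, hf.prob_neg_one, ENNReal.add_halves] at hu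
    exact (prob_compl_eq_zero_iff (hm1.union hm)).2 hu
  filter_upwards [ae_all_iff.2 h] with ω hω p hp
  exact hω ⟨p, hp⟩

theorem integral_prime (hf : IsRandomCompletelyMultiplicative P f) (p : Nat.Primes) :
    ∫ ω, f ω (p : ℕ) ∂P = 0 := by
  have hm : MeasurableSet {ω | f ω (p : ℕ) = -1} :=
    hf.measurable_prime p (measurableSet_singleton _)
  have hm1 : MeasurableSet {ω | f ω (p : ℕ) = 1} :=
    hf.measurable_prime p (measurableSet_singleton _)
  have he : (fun ω => f ω (p : ℕ)) =ᵐ[P] fun ω =>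
      {ω | f ω (p : ℕ) = 1}.indicator (fun _ => (1 : ℝ)) ω -
        {ω | f ω (p : ℕ) = -1}.indicator (fun _ => (1 : ℝ)) ω := by
    filter_upwards [hf.ae_eq_one_or_neg_one] with ω hω
    rcases hω p p.2 with h | h <;> simp [Set.indicator, h] <;> norm_num
  rw [integral_congr_ae he, integral_sub ((integrable_const _).indicator hm1)
    ((integrable_const _).indicator hm), integral_indicator_const _ hm1,
    integral_indicator_const _ hm]
  simp [Measure.real, hf.prob_one, hf.prob_neg_one]

/-- A centred sign is independent of everything determined by the other primes. This serves both as
the martingale property in the exponential moment bound and as orthogonality in the mean-square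
bound. -/
theorem integral_prime_mul_eq_zero (hf : IsRandomCompletelyMultiplicative P f) {q : Nat.Primes}
    {T : Set Nat.Primes} (hq : q ∉ T) {H : Ω → ℝ} (hH : Measurable[primesSigma f T] H) :
    ∫ ω, f ω (q : ℕ) * H ω ∂P = 0 := by
  have hind := indep_iSup_of_disjoint (fun p : Nat.Primes => (hf.measurable_prime p).comap_le)
    ((iIndepFun_iff_iIndep _ _ _).1 hf.indep) (S := {q}) (T := T)
    (Set.disjoint_singleton_left.2 hq)
  have hind2 : IndepFun (fun ω => f ω (q : ℕ)) H P := by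
    rw [IndepFun_iff_Indep]
    refine indep_of_indep_of_le_left (indep_of_indep_of_le_right hind ?_) ?_
    · exact hH.comap_le
    · simp
  have := hind2.integral_mul_eq_mul_integral (hf.measurable_prime q).aestronglyMeasurable
    (hH.mono (hf.primesSigma_le T) le_rfl).aestronglyMeasurable
  rw [hf.integral_prime, zero_mul] at this
  exact this

end IsRandomCompletelyMultiplicative

/-! ### Exponential moments and the tail of the rough part. -/

namespace IsRandomCompletelyMultiplicative

variable {Ω : Type*} [MeasurableSpace Ω] {P : Measure Ω} [IsProbabilityMeasure P]
  {f : Ω → (ℕ →*₀ ℝ)}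

/-- An exponential moment bound for the contribution of the integers that are not `N`-smooth,
of Azuma–Hoeffding type. -/
theorem integral_exp_smoothPartialSum_sub_le (hf : IsRandomCompletelyMultiplicative P f)
    (A : Set ℕ) (X : ℕ) {N K : ℕ} (hNK : N ≤ K) {l : ℝ} (hl : 0 ≤ l) {h : ℝ}
    (hh : ∑ n ∈ Finset.Ico 1 X, 1 / (n : ℝ) ≤ h) :
    Integrable (fun ω => Real.exp (-l * (smoothPartialSum A (f ω) X K -
      smoothPartialSum A (f ω) X N))) P ∧
    ∫ ω, Real.exp (-l * (smoothPartialSum A (f ω) X K - smoothPartialSum A (f ω) X N)) ∂P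
      ≤ Real.exp ((l ^ 2 * h ^ 2 / 2 + l * h) * ∑ j ∈ Finset.Ico N K, 1 / (j : ℝ) ^ 2) := by
  have hh0 : 0 ≤ h := le_trans (Finset.sum_nonneg fun _ _ => by positivity) hh
  have hmeasF : ∀ k, Measurable fun ω => smoothPartialSum A (f ω) X k := fun k =>
    (measurable_smoothPartialSum f A X k).mono (hf.primesSigma_le _) le_rfl
  have hint : ∀ k, Integrable (fun ω => Real.exp (-l * (smoothPartialSum A (f ω) X k -
      smoothPartialSum A (f ω) X N))) P := by
    intro k
    refine Integrable.of_bound (C := Real.exp (l * (2 * h)))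
      (((hmeasF k).sub (hmeasF N)).const_mul _).exp.aestronglyMeasurable ?_
    filter_upwards [hf.ae_eq_one_or_neg_one] with ω hω
    have h1 := abs_le.1 ((abs_smoothPartialSum_le A (abs_le_one_of_primes hω) X k).trans hh)
    have h2 := abs_le.1 ((abs_smoothPartialSum_le A (abs_le_one_of_primes hω) X N).trans hh)
    rw [Real.norm_of_nonneg (Real.exp_pos _).le]
    refine Real.exp_le_exp.2 ?_
    nlinarith
  refine ⟨hint K, ?_⟩
  induction K, hNK using Nat.le_induction with
  | base => simp
  | succ p hNp ih =>
    rw [Finset.sum_Ico_succ_top hNp, mul_add, Real.exp_add]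
    have hc0 : 0 ≤ l ^ 2 * h ^ 2 / 2 + l * h := by positivity
    by_cases hp : p.Prime
    swap
    · simp only [smoothPartialSum_succ_of_not_prime A _ X hp]
      refine ih.trans (le_mul_of_one_le_right (Real.exp_pos _).le (Real.one_le_exp ?_))
      positivity
    set c := (l ^ 2 * h ^ 2 / 2 + l * h) * (1 / (p : ℝ) ^ 2) with hc
    set W : Ω → ℝ := fun ω => Real.exp (-l * (smoothPartialSum A (f ω) X p -
      smoothPartialSum A (f ω) X N)) with hW
    set D : Ω → ℝ := fun ω => smoothCofactorSum A (f ω) X p with hD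
    -- For a sign ε, exp(-εy) = cosh y - ε sinh y. The sinh part integrates to zero against the past
    -- and cosh y ≤ exp(y²/2). The square term may itself depend on the sign at p, so it is bounded
    -- by a constant before this splitting; that constant is the exponential factor in `V`.
    set V : Ω → ℝ := fun ω => Real.exp (l * h / p ^ 2) * (W ω * Real.sinh (l * D ω)) with hV
    have hp0 : (0 : ℝ) < p := by exact_mod_cast hp.pos
    have hp1 : (1 : ℝ) ≤ p := by exact_mod_cast hp.one_lt.le
    have hWm : Measurable[primesSigma f {q | (q : ℕ) < p}] W := by
      refine Real.measurable_exp.comp (Measurable.const_mul (Measurable.sub ?_ ?_) _)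
      · exact measurable_smoothPartialSum f A X p
      · refine (measurable_smoothPartialSum f A X N).mono (primesSigma_mono f ?_) le_rfl
        exact fun q hq => lt_of_lt_of_le hq hNp
    have hDm : Measurable[primesSigma f {q | (q : ℕ) < p}] D :=
      measurable_smoothCofactorSum f A X p
    have hVm : Measurable[primesSigma f {q | (q : ℕ) < p}] V :=
      Measurable.const_mul (hWm.mul (Real.measurable_sinh.comp (hDm.const_mul _))) _
    have hzero : ∫ ω, f ω p * V ω ∂P = 0 :=
      hf.integral_prime_mul_eq_zero (q := ⟨p, hp⟩) (fun h => lt_irrefl p h) hVm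
    have hDb : ∀ᵐ ω ∂P, |D ω| ≤ h / p := by
      filter_upwards [hf.ae_eq_one_or_neg_one] with ω hω
      exact (abs_smoothCofactorSum_le A (abs_le_one_of_primes hω) X p).trans
        (div_le_div_of_nonneg_right hh hp0.le)
    have hpoint : ∀ᵐ ω ∂P, Real.exp (-l * (smoothPartialSum A (f ω) X (p + 1) -
        smoothPartialSum A (f ω) X N)) ≤ W ω * Real.exp c - f ω p * V ω := by
      filter_upwards [hf.ae_eq_one_or_neg_one, hDb] with ω hω hDω
      have hE := abs_le.1 ((abs_smoothSquareSum_le A (abs_le_one_of_primes hω) X hp.pos).trans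
        (div_le_div_of_nonneg_right hh (sq_nonneg (p : ℝ))))
      have e1 : -l * (smoothPartialSum A (f ω) X (p + 1) - smoothPartialSum A (f ω) X N) =
          -l * (smoothPartialSum A (f ω) X p - smoothPartialSum A (f ω) X N)
            + -(l * smoothSquareSum A (f ω) X p) + -(f ω p * (l * D ω)) := by
        rw [smoothPartialSum_succ_of_prime A (f ω) X hp]
        ring
      have e2 : Real.exp (-(f ω p * (l * D ω))) =
          Real.cosh (l * D ω) - f ω p * Real.sinh (l * D ω) := by
        rcases hω p hp with h | h <;> rw [h]
        · rw [one_mul, one_mul, Real.cosh_sub_sinh]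
        · rw [neg_mul, neg_neg, one_mul, neg_mul, sub_neg_eq_add, one_mul, Real.cosh_add_sinh]
      have e3 : Real.exp (-(l * smoothSquareSum A (f ω) X p)) ≤ Real.exp (l * h / p ^ 2) := by
        refine Real.exp_le_exp.2 ?_
        rw [mul_div_assoc]
        nlinarith
      have e4 : Real.cosh (l * D ω) ≤ Real.exp (l ^ 2 * h ^ 2 / 2 * (1 / (p : ℝ) ^ 2)) := by
        refine (Real.cosh_le_exp_half_sq _).trans (Real.exp_le_exp.2 ?_)
        have : D ω ^ 2 ≤ (h / p) ^ 2 := sq_le_sq' (by linarith [(abs_le.1 hDω).1]) (abs_le.1 hDω).2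
        rw [mul_pow]
        rw [div_pow] at this
        have h5 := mul_le_mul_of_nonneg_left this (sq_nonneg l)
        calc l ^ 2 * D ω ^ 2 / 2 ≤ l ^ 2 * (h ^ 2 / (p : ℝ) ^ 2) / 2 := by linarith
          _ = _ := by ring
      have e5 : 0 ≤ Real.cosh (l * D ω) - f ω p * Real.sinh (l * D ω) := by
        rw [← e2]; exact (Real.exp_pos _).le
      rw [e1, Real.exp_add, Real.exp_add, e2]
      have hW0 : 0 < W ω := Real.exp_pos _
      calc W ω * Real.exp (-(l * smoothSquareSum A (f ω) X p)) *
            (Real.cosh (l * D ω) - f ω p * Real.sinh (l * D ω))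
          ≤ W ω * Real.exp (l * h / p ^ 2) *
            (Real.cosh (l * D ω) - f ω p * Real.sinh (l * D ω)) :=
            mul_le_mul_of_nonneg_right (mul_le_mul_of_nonneg_left e3 hW0.le) e5
        _ = W ω * (Real.exp (l * h / p ^ 2) * Real.cosh (l * D ω)) - f ω p * V ω := by
            rw [hV]; ring
        _ ≤ _ := by
            refine sub_le_sub_right (mul_le_mul_of_nonneg_left ?_ hW0.le) _
            rw [hc, add_mul, Real.exp_add, mul_comm (Real.exp _), div_eq_mul_one_div (l * h)]
            exact mul_le_mul_of_nonneg_right e4 (Real.exp_pos _).le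
    have hVint : Integrable (fun ω => f ω p * V ω) P := by
      have hVm' := hVm.mono (hf.primesSigma_le _) le_rfl
      refine Integrable.of_bound
        (C := Real.exp (l * h / p ^ 2) * (Real.exp (l * (2 * h)) * Real.exp (l * h)))
        ((hf.measurable_prime ⟨p, hp⟩).mul hVm').aestronglyMeasurable ?_
      filter_upwards [hf.ae_eq_one_or_neg_one, hDb] with ω hω hDω
      have h1 := abs_le.1 ((abs_smoothPartialSum_le A (abs_le_one_of_primes hω) X p).trans hh)
      have h2 := abs_le.1 ((abs_smoothPartialSum_le A (abs_le_one_of_primes hω) X N).trans hh)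
      rw [Real.norm_eq_abs, abs_mul, abs_eq_one_of_primes hω hp.ne_zero, one_mul, hV, abs_mul,
        abs_of_pos (Real.exp_pos _), abs_mul, abs_of_pos (Real.exp_pos _)]
      refine mul_le_mul_of_nonneg_left (mul_le_mul (Real.exp_le_exp.2 (by nlinarith)) ?_
        (abs_nonneg _) (Real.exp_pos _).le) (Real.exp_pos _).le
      have h3 : |l * D ω| ≤ l * h := by
        rw [abs_mul, abs_of_nonneg hl]
        exact mul_le_mul_of_nonneg_left (hDω.trans (div_le_self hh0 hp1)) hl
      rw [Real.abs_sinh, Real.sinh_eq]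
      have h4 := Real.exp_le_exp.2 h3
      have h5 := Real.exp_pos (-|l * D ω|)
      linarith [Real.exp_pos (l * h)]
    calc _ ≤ ∫ ω, (W ω * Real.exp c - f ω p * V ω) ∂P :=
          integral_mono_ae (hint (p + 1)) (((hint p).mul_const _).sub hVint) hpoint
      _ = (∫ ω, W ω ∂P) * Real.exp c := by
          rw [integral_sub ((hint p).mul_const _) hVint, hzero, sub_zero, integral_mul_const]
      _ ≤ _ := mul_le_mul_of_nonneg_right ih (Real.exp_pos _).le

/-- Chernoff's bound applied to the exponential moment, with ∑_{j ≥ N} 1/j² ≤ 2/N. -/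
theorem measure_smoothPartialSum_sub_le_le (hf : IsRandomCompletelyMultiplicative P f)
    (A : Set ℕ) (X : ℕ) {N K : ℕ} (hN : 0 < N) (hNK : N ≤ K) {h : ℝ} (hh1 : 1 ≤ h)
    (hh : ∑ n ∈ Finset.Ico 1 X, 1 / (n : ℝ) ≤ h) {t : ℝ} (ht0 : 0 ≤ t) (ht1 : t ≤ 1) :
    P.real {ω | smoothPartialSum A (f ω) X K - smoothPartialSum A (f ω) X N ≤ -t}
      ≤ Real.exp 1 * Real.exp (-(t ^ 2 * N / (4 * h ^ 2))) := by
  -- This minimises -lt + l²h²/N. The remaining linear term 2lh/N equals t/h ≤ 1 and accounts for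
  -- the factor e.
  set l := t * N / (2 * h ^ 2) with hl
  have hl0 : 0 ≤ l := by positivity
  obtain ⟨hint, hle⟩ := hf.integral_exp_smoothPartialSum_sub_le A X hNK hl0 hh
  have hN0 : (0 : ℝ) < N := by exact_mod_cast hN
  have hmk := mul_meas_ge_le_integral_of_nonneg
    (Eventually.of_forall fun ω => (Real.exp_pos _).le) hint (Real.exp (l * t))
  have hset : {ω | smoothPartialSum A (f ω) X K - smoothPartialSum A (f ω) X N ≤ -t} ⊆
      {ω | Real.exp (l * t) ≤ Real.exp (-l * (smoothPartialSum A (f ω) X K -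
        smoothPartialSum A (f ω) X N))} := by
    intro ω hω
    simp only [Set.mem_ofPred_eq] at hω ⊢
    refine Real.exp_le_exp.2 ?_
    nlinarith
  have hP := measureReal_mono (μ := P) hset
  have h1 : P.real {ω | smoothPartialSum A (f ω) X K - smoothPartialSum A (f ω) X N ≤ -t} ≤
      Real.exp (-(l * t)) * Real.exp ((l ^ 2 * h ^ 2 / 2 + l * h) *
        ∑ j ∈ Finset.Ico N K, 1 / (j : ℝ) ^ 2) := by
    rw [Real.exp_neg, inv_mul_eq_div, le_div_iff₀ (Real.exp_pos _), mul_comm]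
    exact (mul_le_mul_of_nonneg_left hP (Real.exp_pos _).le).trans (hmk.trans hle)
  refine h1.trans ?_
  rw [← Real.exp_add, ← Real.exp_add]
  refine Real.exp_le_exp.2 ?_
  have h2 := mul_le_mul_of_nonneg_left (sum_Ico_one_div_sq_le hN K)
    (by positivity : 0 ≤ l ^ 2 * h ^ 2 / 2 + l * h)
  have e : -(l * t) + (l ^ 2 * h ^ 2 / 2 + l * h) * (2 / N) =
      t / h + -(t ^ 2 * N / (4 * h ^ 2)) := by
    rw [hl]
    field_simp
    ring
  have h3 : t / h ≤ 1 := (div_le_one (by linarith)).2 (by linarith)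
  linarith

end IsRandomCompletelyMultiplicative

/-! ### Mean square of the rough part when the small signs are frozen. -/

/-- When all signs are ±1 the square drops out and f(n) = f(a)f(s). Only the primes ≥ N are split
into a squarefree part and a square, since the signs below N will be frozen. In the induction a new
large prime either enters s or moves from s into u. -/
theorem exists_smooth_mul_squarefree_mul_sq (N n : ℕ) (hn : n ≠ 0) :
    ∃ a s u : ℕ, n = a * s * u ^ 2 ∧ a ∈ Nat.smoothNumbers N ∧ Squarefree s ∧
      (∀ q : ℕ, q.Prime → q ∣ s → N ≤ q) ∧ (∀ q : ℕ, q.Prime → q ∣ u → N ≤ q) := by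
  have h1 : ∀ q : ℕ, q.Prime → q ∣ 1 → N ≤ q := fun q hq h =>
    absurd (Nat.dvd_one.1 h) hq.ne_one
  induction n using induction_on_primes with
  | zero => exact absurd rfl hn
  | one =>
    refine ⟨1, 1, 1, by norm_num, ?_, squarefree_one, h1, h1⟩
    exact Nat.mem_smoothNumbers'.2 fun q hq h => absurd (Nat.dvd_one.1 h) hq.ne_one
  | prime_mul p n hp ih =>
    obtain ⟨a, s, u, rfl, ha, hs, hsr, hur⟩ := ih (right_ne_zero_of_mul hn)
    rcases lt_or_ge p N with hpN | hpN
    · refine ⟨p * a, s, u, by ring, Nat.mul_mem_smoothNumbers ?_ ha, hs, hsr, hur⟩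
      rw [Nat.mem_smoothNumbers']
      intro q hq h
      rwa [(Nat.prime_dvd_prime_iff_eq hq hp).1 h]
    · by_cases hps : p ∣ s
      · obtain ⟨k, rfl⟩ := hps
        refine ⟨a, k, p * u, by ring, ha, hs.squarefree_of_dvd (dvd_mul_left k p),
          fun q hq h => hsr q hq (h.mul_left p), fun q hq h => ?_⟩
        rcases hq.dvd_mul.1 h with h | h
        · rwa [(Nat.prime_dvd_prime_iff_eq hq hp).1 h]
        · exact hur q hq h
      · refine ⟨a, p * s, u, by ring, ha, ?_, fun q hq h => ?_, hur⟩
        · exact (Nat.squarefree_mul_iff).2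
            ⟨(hp.coprime_iff_not_dvd).2 hps, hp.prime.squarefree, hs⟩
        · rcases hq.dvd_mul.1 h with h | h
          · rwa [(Nat.prime_dvd_prime_iff_eq hq hp).1 h]
          · exact hsr q hq h

theorem le_of_forall_prime_dvd_le {N n : ℕ} (hn0 : n ≠ 0) (hn1 : n ≠ 1)
    (h : ∀ q : ℕ, q.Prime → q ∣ n → N ≤ q) : N ≤ n :=
  (h _ (Nat.minFac_prime hn1) (Nat.minFac_dvd n)).trans (Nat.minFac_le (Nat.pos_of_ne_zero hn0))

/-- The sum of the squares of the coefficients of the squarefree rough numbers, which bounds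
the mean square of the contribution of the integers that are not `N`-smooth. -/
theorem sum_sq_sum_smooth_mul_squarefree_le {N X : ℕ} (hN : 0 < N) {L : ℝ}
    (hL : ∑ a ∈ Finset.Ico 1 X with a ∈ Nat.smoothNumbers N, 1 / (a : ℝ) ≤ L)
    (R : Finset ℕ) (hR : ∀ n ∈ R, 1 ≤ n ∧ n < X ∧ n ∉ Nat.smoothNumbers N)
    (a s u : ℕ → ℕ) (hdec : ∀ n, n ≠ 0 → n = a n * s n * u n ^ 2 ∧ a n ∈ Nat.smoothNumbers N ∧
      Squarefree (s n) ∧ (∀ q : ℕ, q.Prime → q ∣ s n → N ≤ q) ∧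
      (∀ q : ℕ, q.Prime → q ∣ u n → N ≤ q)) :
    ∑ r ∈ R.image s, (∑ n ∈ R with s n = r, 1 / (n : ℝ)) ^ 2 ≤ 12 * L ^ 2 / N := by
  have hL0 : 0 ≤ L := le_trans (Finset.sum_nonneg fun _ _ => by positivity) hL
  have hN0 : (0 : ℝ) < N := by exact_mod_cast hN
  have hN1 : (1 : ℝ) ≤ N := by exact_mod_cast hN
  have hpos : ∀ n ∈ R, 0 < a n ∧ 0 < s n ∧ 0 < u n := by
    intro n hn
    have h0 : n ≠ 0 := by have := hR n hn; omega
    have h := (hdec n h0).1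
    refine ⟨Nat.pos_of_ne_zero fun h1 => h0 ?_, Nat.pos_of_ne_zero fun h1 => h0 ?_,
      Nat.pos_of_ne_zero fun h1 => h0 ?_⟩ <;> rw [h, h1] <;> ring
  -- With s fixed to r, n = a r u² is determined by (a, u), so the sum factors into 1/r, a smooth
  -- sum and ∑ 1/u².
  have hgen : ∀ (r : ℕ) (U : Finset ℕ), (∀ n ∈ R, s n = r → u n ∈ U) → 0 < r →
      ∑ n ∈ R with s n = r, 1 / (n : ℝ) ≤ 1 / r * (L * ∑ v ∈ U, 1 / (v : ℝ) ^ 2) := by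
    intro r U hU hr
    have hr0 : (0 : ℝ) < r := by exact_mod_cast hr
    refine le_trans ?_ (mul_le_mul_of_nonneg_left (mul_le_mul_of_nonneg_right hL
      (Finset.sum_nonneg fun _ _ => by positivity)) (by positivity))
    rw [Finset.sum_mul_sum, ← Finset.sum_product', Finset.mul_sum]
    refine Finset.sum_le_sum_of_injOn_of_nonneg (fun n => (a n, u n)) ?_ ?_ ?_
      fun _ _ => by positivity
    · intro n hn n' hn' h
      simp only [Finset.coe_filter, Set.mem_ofPred_eq] at hn hn'
      simp only [Prod.mk.injEq] at h
      have h0 : n ≠ 0 := by have := hR n hn.1; omega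
      have h0' : n' ≠ 0 := by have := hR n' hn'.1; omega
      rw [(hdec n h0).1, (hdec n' h0').1, h.1, h.2, hn.2, hn'.2]
    · intro n hn
      rw [Finset.mem_filter] at hn
      have h0 : n ≠ 0 := by have := hR n hn.1; omega
      have hd := hdec n h0
      have hp := hpos n hn.1
      simp only [Finset.mem_product, Finset.mem_filter, Finset.mem_Ico]
      refine ⟨⟨⟨hp.1, ?_⟩, hd.2.1⟩, hU n hn.1 hn.2⟩
      refine lt_of_le_of_lt (Nat.le_of_dvd (Nat.pos_of_ne_zero h0) ?_) (hR n hn.1).2.1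
      exact ⟨s n * u n ^ 2, by rw [← mul_assoc]; exact hd.1⟩
    · intro n hn
      rw [Finset.mem_filter] at hn
      have h0 : n ≠ 0 := by have := hR n hn.1; omega
      have hd := congrArg (Nat.cast : ℕ → ℝ) (hdec n h0).1
      have hp := hpos n hn.1
      rw [hn.2] at hd
      push_cast at hd
      have e1 : (0 : ℝ) < a n := by exact_mod_cast hp.1
      have e2 : (0 : ℝ) < u n := by exact_mod_cast hp.2.2
      rw [hd]
      apply le_of_eq
      field_simp
  have hule : ∀ n ∈ R, u n < X := by
    intro n hn
    have h0 : n ≠ 0 := by have := hR n hn; omega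
    refine lt_of_le_of_lt (Nat.le_of_dvd (Nat.pos_of_ne_zero h0) ?_) (hR n hn).2.1
    exact ⟨a n * s n * u n, by rw [mul_comm, mul_assoc, ← pow_two]; exact (hdec n h0).1⟩
  -- Here u = 1 is impossible because n is not smooth, so u ≥ N, and ∑ 1/u² supplies the decay in N
  -- that 1/r cannot give. This part contributes 4 and the r ≥ N contribute 8 to the constant 12.
  have hone : (∑ n ∈ R with s n = 1, 1 / (n : ℝ)) ^ 2 ≤ (2 * L / N) ^ 2 := by
    refine pow_le_pow_left₀ (Finset.sum_nonneg fun _ _ => by positivity) ?_ 2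
    refine (hgen 1 (Finset.Ico N X) (fun n hn hs => ?_) one_pos).trans ?_
    · rw [Finset.mem_Ico]
      refine ⟨?_, hule n hn⟩
      have h0 : n ≠ 0 := by have := hR n hn; omega
      refine le_of_forall_prime_dvd_le (hpos n hn).2.2.ne' (fun hu => ?_) (hdec n h0).2.2.2.2
      refine (hR n hn).2.2 ?_
      have := (hdec n h0).1
      rw [hs, hu, one_pow, mul_one, mul_one] at this
      rw [this]
      exact (hdec n h0).2.1
    · have := mul_le_mul_of_nonneg_left (sum_Ico_one_div_sq_le hN X) hL0
      rw [Nat.cast_one, div_one, one_mul]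
      refine this.trans (le_of_eq (by ring))
  have hbig : ∀ r ∈ Finset.Ico N X,
      (∑ n ∈ R with s n = r, 1 / (n : ℝ)) ^ 2 ≤ (2 * L) ^ 2 * (1 / (r : ℝ) ^ 2) := by
    intro r hr
    rw [Finset.mem_Ico] at hr
    have hr0 : 0 < r := by omega
    have h1 := hgen r (Finset.Ico 1 X) (fun n hn _ => Finset.mem_Ico.2
      ⟨(hpos n hn).2.2, hule n hn⟩) hr0
    have h2 := mul_le_mul_of_nonneg_left (sum_Ico_one_div_sq_le one_pos X) hL0
    have h3 : ∑ n ∈ R with s n = r, 1 / (n : ℝ) ≤ 2 * L * (1 / r) := by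
      refine h1.trans ((mul_le_mul_of_nonneg_left h2 (by positivity)).trans (le_of_eq ?_))
      rw [Nat.cast_one]; ring
    refine (pow_le_pow_left₀ (Finset.sum_nonneg fun _ _ => by positivity) h3 2).trans
      (le_of_eq ?_)
    rw [mul_pow, div_pow, one_pow]
  have hsub : R.image s ⊆ insert 1 (Finset.Ico N X) := by
    intro r hr
    rw [Finset.mem_image] at hr
    obtain ⟨n, hn, rfl⟩ := hr
    rw [Finset.mem_insert, Finset.mem_Ico]
    by_cases h : s n = 1
    · exact Or.inl h
    have h0 : n ≠ 0 := by have := hR n hn; omega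
    refine Or.inr ⟨le_of_forall_prime_dvd_le (hpos n hn).2.1.ne' h (hdec n h0).2.2.2.1, ?_⟩
    refine lt_of_le_of_lt (Nat.le_of_dvd (Nat.pos_of_ne_zero h0) ?_) (hR n hn).2.1
    exact ⟨a n * u n ^ 2, by rw [← mul_assoc, mul_comm (s n)]; exact (hdec n h0).1⟩
  refine (Finset.sum_le_sum_of_subset_of_nonneg hsub fun _ _ _ => sq_nonneg _).trans ?_
  have hins : ∑ r ∈ insert 1 (Finset.Ico N X), (∑ n ∈ R with s n = r, 1 / (n : ℝ)) ^ 2 ≤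
      (∑ n ∈ R with s n = 1, 1 / (n : ℝ)) ^ 2 +
        ∑ r ∈ Finset.Ico N X, (∑ n ∈ R with s n = r, 1 / (n : ℝ)) ^ 2 := by
    by_cases h : 1 ∈ Finset.Ico N X
    · rw [Finset.insert_eq_of_mem h]
      exact le_add_of_nonneg_left (sq_nonneg _)
    · rw [Finset.sum_insert h]
  refine hins.trans ((add_le_add hone (Finset.sum_le_sum hbig)).trans ?_)
  rw [← Finset.mul_sum]
  have h1 := mul_le_mul_of_nonneg_left (sum_Ico_one_div_sq_le hN X) (sq_nonneg (2 * L))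
  have h2 : (2 * L / N) ^ 2 ≤ 4 * L ^ 2 / N := by
    rw [div_pow, mul_pow, div_le_div_iff₀ (by positivity) hN0]
    nlinarith [mul_nonneg (sq_nonneg L) (mul_nonneg hN0.le (sub_nonneg.2 hN1))]
  refine (add_le_add h2 h1).trans (le_of_eq ?_)
  ring

namespace IsRandomCompletelyMultiplicative

variable {Ω : Type*} [MeasurableSpace Ω] {P : Measure Ω} [IsProbabilityMeasure P]
  {f : Ω → (ℕ →*₀ ℝ)}

/-- Distinct squarefree integers are separated by a prime q dividing exactly one of them. Since q ≥
N, the factor `I` does not see q, and the sign at q can be pulled out. -/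
theorem integral_mul_squarefree_eq_zero (hf : IsRandomCompletelyMultiplicative P f) {N : ℕ}
    {I : Ω → ℝ} (hI : Measurable[primesSigma f {p | (p : ℕ) < N}] I) {s t : ℕ}
    (hs : Squarefree s) (ht : Squarefree t) (hsr : ∀ q : ℕ, q.Prime → q ∣ s → N ≤ q)
    (htr : ∀ q : ℕ, q.Prime → q ∣ t → N ≤ q) (hst : s ≠ t) :
    ∫ ω, I ω * (f ω s * f ω t) ∂P = 0 := by
  have key : ∀ s t : ℕ, Squarefree s → t ≠ 0 → ∀ q : ℕ, q.Prime → q ∣ s → N ≤ q → ¬ q ∣ t →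
      ∫ ω, I ω * (f ω s * f ω t) ∂P = 0 := by
    intro s t hs ht q hq hqs hNq hqt
    obtain ⟨k, rfl⟩ := hqs
    have hqk : ¬ q ∣ k := by
      rintro ⟨j, rfl⟩
      exact hq.ne_one (Nat.isUnit_iff.1 (hs q ⟨j, by ring⟩))
    have hk : k ≠ 0 := by rintro rfl; exact hqk (dvd_zero q)
    have hm : ∀ n : ℕ, n ≠ 0 → ¬ q ∣ n →
        Measurable[primesSigma f {p | p ≠ ⟨q, hq⟩}] fun ω => f ω n := by
      intro n hn hqn
      refine measurable_primesSigma f _ n hn fun p hp => ?_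
      rintro rfl
      exact hqn hp
    have hIm : Measurable[primesSigma f {p | p ≠ ⟨q, hq⟩}] I := by
      refine hI.mono (primesSigma_mono f ?_) le_rfl
      rintro p hp rfl
      exact absurd hNq (not_le.2 hp)
    have := hf.integral_prime_mul_eq_zero (q := ⟨q, hq⟩) (T := {p | p ≠ ⟨q, hq⟩}) (fun h => h rfl)
      (hIm.mul ((hm k hk hqk).mul (hm t ht hqt)))
    rw [← this]
    refine integral_congr_ae (Eventually.of_forall fun ω => ?_)
    simp only [map_mul, Pi.mul_apply]
    ring
  have hne : s.primeFactors ≠ t.primeFactors := by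
    intro h
    exact hst (by rw [← Nat.prod_primeFactors_of_squarefree hs, h,
      Nat.prod_primeFactors_of_squarefree ht])
  have hex : ∃ q : ℕ, q.Prime ∧ ((q ∣ s ∧ ¬ q ∣ t) ∨ (q ∣ t ∧ ¬ q ∣ s)) := by
    by_contra hcon
    push Not at hcon
    refine hne (Finset.ext fun q => ?_)
    rw [Nat.mem_primeFactors, Nat.mem_primeFactors]
    exact ⟨fun h => ⟨h.1, (hcon q h.1).1 h.2.1, ht.ne_zero⟩,
      fun h => ⟨h.1, (hcon q h.1).2 h.2.1, hs.ne_zero⟩⟩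
  obtain ⟨q, hq, h | h⟩ := hex
  · exact key s t hs ht.ne_zero q hq h.1 (hsr q hq h.1) h.2
  · simp only [mul_comm (f _ s)]
    exact key t s ht hs.ne_zero q hq h.1 (htr q hq h.1) h.2

/-- On `E` the smooth factors take the deterministic values of `g`, so the rough part is ∑ B_r f(r)
over squarefree rough r. The cross terms vanish even against the indicator of `E`, leaving P(E) ∑
B_r². -/
theorem integral_indicator_mul_sq_le (hf : IsRandomCompletelyMultiplicative P f) (A : Set ℕ)
    {N X : ℕ} (hN : 0 < N) {L : ℝ}
    (hL : ∑ a ∈ Finset.Ico 1 X with a ∈ Nat.smoothNumbers N, 1 / (a : ℝ) ≤ L)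
    {g : ℕ →*₀ ℝ} (hg : ∀ p : ℕ, p.Prime → g p = 1 ∨ g p = -1)
    {E : Set Ω} (hE : MeasurableSet[primesSigma f {p | (p : ℕ) < N}] E)
    (hEg : ∀ ω ∈ E, ∀ p ∈ N.primesBelow, f ω p = g p) :
    Integrable (fun ω => E.indicator (fun _ => (1 : ℝ)) ω *
      (smoothPartialSum A (f ω) X X - smoothPartialSum A (f ω) X N) ^ 2) P ∧
    ∫ ω, E.indicator (fun _ => (1 : ℝ)) ω *
      (smoothPartialSum A (f ω) X X - smoothPartialSum A (f ω) X N) ^ 2 ∂P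
      ≤ P.real E * (12 * L ^ 2 / N) := by
  classical
  choose! a s u hdec using exists_smooth_mul_squarefree_mul_sq N
  set I : Ω → ℝ := E.indicator (fun _ => (1 : ℝ)) with hI
  have hIm : Measurable[primesSigma f {p | (p : ℕ) < N}] I := measurable_const.indicator hE
  have hEm : MeasurableSet E := hf.primesSigma_le _ _ hE
  have hIm' : Measurable I := hIm.mono (hf.primesSigma_le _) le_rfl
  set R : Finset ℕ := {n ∈ Finset.Ico 1 X | n ∈ A ∧ n ∉ Nat.smoothNumbers N} with hRdef
  have hR : ∀ n ∈ R, 1 ≤ n ∧ n < X ∧ n ∉ Nat.smoothNumbers N := by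
    intro n hn
    rw [hRdef, Finset.mem_filter, Finset.mem_Ico] at hn
    exact ⟨hn.1.1, hn.1.2, hn.2.2⟩
  have hdiff : ∀ ω, smoothPartialSum A (f ω) X X - smoothPartialSum A (f ω) X N =
      ∑ n ∈ R, f ω n / n := by
    intro ω
    rw [sub_eq_iff_eq_add, hRdef]
    unfold smoothPartialSum
    rw [← Finset.sum_filter_add_sum_filter_not (Finset.filter _ _)
      (fun n => n ∉ Nat.smoothNumbers N), Finset.filter_filter, Finset.filter_filter]
    congr 1
    · refine Finset.sum_congr (Finset.filter_congr fun n hn => ?_) fun _ _ => rfl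
      rw [Finset.mem_Ico] at hn
      have := Nat.mem_smoothNumbers_of_lt hn.1 hn.2
      tauto
    · refine Finset.sum_congr (Finset.filter_congr fun n hn => ?_) fun _ _ => rfl
      rw [Finset.mem_Ico] at hn
      have := Nat.mem_smoothNumbers_of_lt hn.1 hn.2
      tauto
  set B : ℕ → ℝ := fun r => ∑ n ∈ R with s n = r, g (a n) / n with hB
  have hsmooth : ∀ ω ∈ E, ∀ k ∈ Nat.smoothNumbers N, f ω k = g k := by
    intro ω hω k hk
    induction k using induction_on_primes with
    | zero => simp
    | one => simp
    | prime_mul p n hp ih =>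
      rw [map_mul, map_mul, ih (Nat.mem_smoothNumbers_of_dvd hk (dvd_mul_left n p)), hEg ω hω p]
      rw [Nat.mem_primesBelow]
      exact ⟨Nat.mem_smoothNumbers'.1 hk p hp (dvd_mul_right p n), hp⟩
  have hexp : ∀ᵐ ω ∂P, I ω * (smoothPartialSum A (f ω) X X - smoothPartialSum A (f ω) X N) ^ 2 =
      ∑ r ∈ R.image s, ∑ t ∈ R.image s, B r * B t * (I ω * (f ω r * f ω t)) := by
    filter_upwards [hf.ae_eq_one_or_neg_one] with ω hω
    by_cases hωE : ω ∈ E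
    · have h1 : ∑ n ∈ R, f ω n / n = ∑ r ∈ R.image s, B r * f ω r := by
        rw [← Finset.sum_fiberwise_of_maps_to (g := s) (t := R.image s)
          fun n hn => Finset.mem_image_of_mem s hn]
        refine Finset.sum_congr rfl fun r _ => ?_
        rw [hB, Finset.sum_mul]
        refine Finset.sum_congr rfl fun n hn => ?_
        rw [Finset.mem_filter] at hn
        have h0 : n ≠ 0 := by have := hR n hn.1; omega
        have hd := hdec n h0
        have hu : u n ≠ 0 := by
          intro hu
          rw [hu] at hd
          exact h0 (by rw [hd.1]; ring)
        have h2 : f ω n = g (a n) * f ω r := by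
          conv_lhs => rw [hd.1]
          rw [map_mul, map_mul, map_pow, ← sq_abs (f ω (u n)), abs_eq_one_of_primes hω hu,
            hsmooth ω hωE _ hd.2.1, hn.2]
          ring
        rw [h2]
        ring
      have h3 : I ω = 1 := Set.indicator_of_mem hωE _
      rw [hdiff, h1, h3, one_mul, pow_two, Finset.sum_mul_sum]
      refine Finset.sum_congr rfl fun r _ => Finset.sum_congr rfl fun t _ => ?_
      ring
    · have h3 : I ω = 0 := Set.indicator_of_notMem hωE _
      simp [h3]
  have hrimg : ∀ r ∈ R.image s, Squarefree r ∧ ∀ q : ℕ, q.Prime → q ∣ r → N ≤ q := by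
    intro r hr
    rw [Finset.mem_image] at hr
    obtain ⟨n, hn, rfl⟩ := hr
    have h0 : n ≠ 0 := by have := hR n hn; omega
    exact ⟨(hdec n h0).2.2.1, (hdec n h0).2.2.2.1⟩
  have hI01 : ∀ ω, 0 ≤ I ω ∧ I ω ≤ 1 := fun ω =>
    ⟨Set.indicator_nonneg (fun _ _ => zero_le_one) ω,
      Set.indicator_le_self' (fun _ _ => zero_le_one) ω⟩
  have hint : ∀ r ∈ R.image s, ∀ t ∈ R.image s,
      Integrable (fun ω => B r * B t * (I ω * (f ω r * f ω t))) P := by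
    intro r hr t ht
    refine Integrable.const_mul (Integrable.of_bound (C := 1) (hIm'.mul
      ((hf.measurable_apply (hrimg r hr).1.ne_zero).mul
      (hf.measurable_apply (hrimg t ht).1.ne_zero))).aestronglyMeasurable ?_) _
    filter_upwards [hf.ae_eq_one_or_neg_one] with ω hω
    rw [Real.norm_eq_abs]
    simp only [Pi.mul_apply]
    rw [abs_mul, abs_mul, abs_eq_one_of_primes hω (hrimg r hr).1.ne_zero,
      abs_eq_one_of_primes hω (hrimg t ht).1.ne_zero, abs_of_nonneg (hI01 ω).1]
    linarith [(hI01 ω).2]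
  have hintS := integrable_finsetSum (R.image s) fun r hr =>
    integrable_finsetSum (R.image s) fun t ht => hint r hr t ht
  refine ⟨hintS.congr (hexp.mono fun ω h => h.symm), ?_⟩
  rw [integral_congr_ae hexp, integral_finsetSum _ fun r hr =>
    integrable_finsetSum (R.image s) fun t ht => hint r hr t ht]
  have hterm : ∀ r ∈ R.image s,
      ∫ ω, ∑ t ∈ R.image s, B r * B t * (I ω * (f ω r * f ω t)) ∂P = B r ^ 2 * P.real E := by
    intro r hr
    rw [integral_finsetSum _ fun t ht => hint r hr t ht, Finset.sum_eq_single_of_mem r hr]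
    · rw [integral_const_mul]
      have : ∫ ω, I ω * (f ω r * f ω r) ∂P = P.real E := by
        rw [← integral_indicator_one hEm]
        refine integral_congr_ae ?_
        filter_upwards [hf.ae_eq_one_or_neg_one] with ω hω
        rw [← abs_mul_abs_self, abs_eq_one_of_primes hω (hrimg r hr).1.ne_zero, mul_one, mul_one]
        rfl
      rw [this, pow_two]
    · intro t ht htr
      rw [integral_const_mul, hf.integral_mul_squarefree_eq_zero hIm (hrimg r hr).1
        (hrimg t ht).1 (hrimg r hr).2 (hrimg t ht).2 htr.symm, mul_zero]
  rw [Finset.sum_congr rfl hterm, ← Finset.sum_mul, mul_comm]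
  refine mul_le_mul_of_nonneg_left ?_ measureReal_nonneg
  refine le_trans (Finset.sum_le_sum fun r _ => ?_)
    (sum_sq_sum_smooth_mul_squarefree_le hN hL R hR a s u hdec)
  refine sq_le_sq' ?_ ?_
  · rw [hB, neg_le, ← Finset.sum_neg_distrib]
    refine Finset.sum_le_sum fun n _ => ?_
    rw [← neg_div]
    exact div_le_div_of_nonneg_right (neg_le.1 (abs_le.1 (abs_le_one_of_primes hg _)).1)
      (by positivity)
  · refine Finset.sum_le_sum fun n _ => ?_
    exact div_le_div_of_nonneg_right (abs_le.1 (abs_le_one_of_primes hg _)).2 (by positivity)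

end IsRandomCompletelyMultiplicative

/-! ### Steering the Euler products by a choice of signs. -/

/-- Greedy choice: always step towards the target. The distance shrinks by the full step until the
target is overshot, and an overshoot is at most `B`. -/
theorem exists_signs_abs_sub_sum_le {ι : Type*} (s : Finset ι) (x : ι → ℝ) {B : ℝ}
    (hx : ∀ i ∈ s, 0 ≤ x i ∧ x i ≤ B) (t : ℝ) :
    ∃ e : ι → ℝ, (∀ i, e i = 1 ∨ e i = -1) ∧
      |t - ∑ i ∈ s, e i * x i| ≤ max B (|t| - ∑ i ∈ s, x i) := by
  classical
  induction s using Finset.induction_on generalizing t with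
  | empty => exact ⟨fun _ => 1, fun _ => Or.inl rfl, by simp⟩
  | insert j s hj ih =>
    have hxj := hx j (Finset.mem_insert_self j s)
    have hxs : ∀ i ∈ s, 0 ≤ x i ∧ x i ≤ B := fun i hi => hx i (Finset.mem_insert_of_mem hi)
    have hs0 : 0 ≤ ∑ i ∈ s, x i := Finset.sum_nonneg fun i hi => (hxs i hi).1
    obtain ⟨σ, hσ, hle⟩ : ∃ σ : ℝ, (σ = 1 ∨ σ = -1) ∧
        |t - σ * x j| ≤ max B (|t| - x j) := by
      rcases le_total 0 t with h | h
      · refine ⟨1, Or.inl rfl, ?_⟩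
        rw [abs_of_nonneg h, one_mul]
        refine abs_le.2 ⟨?_, le_max_right _ _⟩
        linarith [le_max_left B (t - x j)]
      · refine ⟨-1, Or.inr rfl, ?_⟩
        rw [abs_of_nonpos h]
        refine abs_le.2 ⟨?_, ?_⟩
        · linarith [le_max_right B (-t - x j)]
        · linarith [le_max_left B (-t - x j)]
    obtain ⟨e, he, hle2⟩ := ih hxs (t - σ * x j)
    refine ⟨Function.update e j σ, fun i => ?_, ?_⟩
    · by_cases h : i = j
      · subst h; simpa using hσ
      · simpa [h] using he i
    · rw [Finset.sum_insert hj, Finset.sum_insert hj, Function.update_self]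
      have : ∑ i ∈ s, Function.update e j σ i * x i = ∑ i ∈ s, e i * x i := by
        refine Finset.sum_congr rfl fun i hi => ?_
        rw [Function.update_of_ne (ne_of_mem_of_not_mem hi hj)]
      rw [this, ← sub_sub]
      refine hle2.trans (max_le (le_max_left _ _) ?_)
      have h3 : max B (|t| - x j) - ∑ i ∈ s, x i ≤ max B (|t| - (x j + ∑ i ∈ s, x i)) := by
        rw [sub_le_iff_le_add]
        refine max_le ?_ ?_
        · linarith [le_max_left B (|t| - (x j + ∑ i ∈ s, x i))]
        · linarith [le_max_right B (|t| - (x j + ∑ i ∈ s, x i))]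
      linarith

theorem DirichletCharacter.inv_apply_eq_conj {m : ℕ} [NeZero m] (χ : DirichletCharacter ℂ m)
    (a : ZMod m) : χ⁻¹ a = (starRingEnd ℂ) (χ a) := by
  rw [starRingEnd_apply, ← MulChar.star_apply, MulChar.star_eq_inv]

theorem IsRealCharacter.inv_eq {m : ℕ} [NeZero m] {χ : DirichletCharacter ℂ m}
    (hχ : IsRealCharacter m χ) : χ⁻¹ = χ := by
  refine MulChar.ext fun a => ?_
  rw [DirichletCharacter.inv_apply_eq_conj]
  exact Complex.conj_eq_iff_im.2 (hχ a)

theorem isRealCharacter_of_inv_eq {m : ℕ} [NeZero m] {χ : DirichletCharacter ℂ m}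
    (hχ : χ⁻¹ = χ) : IsRealCharacter m χ := by
  intro a
  have := DirichletCharacter.inv_apply_eq_conj χ a
  rw [hχ] at this
  exact Complex.conj_eq_iff_im.1 this.symm

theorem charCoeff_inv {m : ℕ} [NeZero m] (S : Finset (ZMod m)ˣ) (χ : DirichletCharacter ℂ m) :
    charCoeff m S χ⁻¹ = (starRingEnd ℂ) (charCoeff m S χ) := by
  unfold charCoeff
  simp only [DirichletCharacter.inv_apply_eq_conj, map_mul, map_sum, map_div₀, map_one,
    map_natCast]

open Classical in
theorem DirichletCharacter.sum_eq_ite {m : ℕ} [NeZero m] (χ : DirichletCharacter ℂ m) :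
    ∑ a : ZMod m, χ a = if χ = 1 then (m.totient : ℂ) else 0 := by
  split_ifs with h
  · rw [h, MulChar.sum_one_eq_card_units, ZMod.card_units_eq_totient]
  · exact MulChar.sum_eq_zero_of_ne_one h

open Classical in
/-- Real weights on the residue classes whose Fourier coefficients are supported on a character
and its conjugate. -/
theorem exists_real_weights {m : ℕ} [NeZero m] (ψ : DirichletCharacter ℂ m) {Z : ℂ}
    (hZ : IsRealCharacter m ψ → Z.im = 0) :
    ∃ t : ZMod m → ℝ, ∀ χ : DirichletCharacter ℂ m, ∑ a : ZMod m, χ a * (t a : ℂ) =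
      if χ = ψ then Z else if χ = ψ⁻¹ then (starRingEnd ℂ) Z else 0 := by
  have hφ : (m.totient : ℂ) ≠ 0 := by
    exact_mod_cast (Nat.totient_pos.2 (Nat.pos_of_ne_zero (NeZero.ne m))).ne'
  have key : ∀ w : ℂ, ∀ χ : DirichletCharacter ℂ m,
      ∑ a : ZMod m, χ a * ((w * ψ⁻¹ a).re : ℂ) =
        (if χ = ψ then w * m.totient / 2 else 0) +
          if χ = ψ⁻¹ then (starRingEnd ℂ) w * m.totient / 2 else 0 := by
    intro w χ
    have h1 : ∀ a : ZMod m, χ a * ((w * ψ⁻¹ a).re : ℂ) =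
        w / 2 * (χ * ψ⁻¹) a + (starRingEnd ℂ) w / 2 * (χ * ψ) a := by
      intro a
      rw [Complex.re_eq_add_conj, map_mul, ← DirichletCharacter.inv_apply_eq_conj, inv_inv,
        MulChar.mul_apply, MulChar.mul_apply]
      ring
    simp only [h1]
    rw [Finset.sum_add_distrib, ← Finset.mul_sum, ← Finset.mul_sum,
      DirichletCharacter.sum_eq_ite, DirichletCharacter.sum_eq_ite]
    simp only [mul_eq_one_iff_eq_inv, inv_inv]
    split_ifs <;> ring
  -- For real ψ the two terms of `key` coincide and add up, so the factor 2 needed for a complex ψ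
  -- must be dropped.
  by_cases hψ : IsRealCharacter m ψ
  · refine ⟨fun a => (Z / m.totient * ψ⁻¹ a).re, fun χ => ?_⟩
    have hcZ : (starRingEnd ℂ) Z = Z := Complex.conj_eq_iff_im.2 (hZ hψ)
    rw [key, hψ.inv_eq]
    simp only [map_div₀, map_natCast, hcZ]
    split_ifs
    · field_simp; ring
    · ring
  · refine ⟨fun a => (2 * Z / m.totient * ψ⁻¹ a).re, fun χ => ?_⟩
    have hne : ψ⁻¹ ≠ ψ := fun h => hψ (isRealCharacter_of_inv_eq h)
    rw [key]
    simp only [map_div₀, map_mul, map_natCast, map_ofNat]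
    split_ifs with h1 h2 h2
    · exact absurd (h2.symm.trans h1) hne
    · field_simp; ring
    · field_simp; ring
    · ring

/-- If the expansion of `S` has a negative real coefficient or a non-zero complex one, then real
weights turn the corresponding terms into prescribed negative numbers. -/
theorem exists_real_weights_of_not_hasNonnegRealExpansion {m : ℕ} [NeZero m]
    {S : Finset (ZMod m)ˣ} (hS : ¬ HasNonnegRealExpansion m S) (Q : DirichletCharacter ℂ m → ℂ)
    (hQ : ∀ χ, Q χ ≠ 0) (hQinv : ∀ χ, Q χ⁻¹ = (starRingEnd ℂ) (Q χ))
    (hQreal : ∀ χ, IsRealCharacter m χ → ∃ r : ℝ, 0 < r ∧ Q χ = r) {W : ℝ} (hW : 0 < W) :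
    ∃ (t : ZMod m → ℝ) (T : Finset (DirichletCharacter ℂ m)), T.Nonempty ∧
      (∀ χ ∈ T, charCoeff m S χ * Q χ * Complex.exp (∑ a : ZMod m, χ a * (t a : ℂ)) = -W) ∧
      ∀ χ ∉ T, ∑ a : ZMod m, χ a * (t a : ℂ) = 0 := by
  classical
  have key : ∀ (ψ : DirichletCharacter ℂ m) (Z : ℂ), (IsRealCharacter m ψ → Z.im = 0) →
      charCoeff m S ψ * Q ψ * Complex.exp Z = -W →
      ∃ (t : ZMod m → ℝ) (T : Finset (DirichletCharacter ℂ m)), T.Nonempty ∧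
      (∀ χ ∈ T, charCoeff m S χ * Q χ * Complex.exp (∑ a : ZMod m, χ a * (t a : ℂ)) = -W) ∧
      ∀ χ ∉ T, ∑ a : ZMod m, χ a * (t a : ℂ) = 0 := by
    intro ψ Z hZ hψ
    obtain ⟨t, ht⟩ := exists_real_weights ψ hZ
    refine ⟨t, {ψ, ψ⁻¹}, ⟨ψ, by simp⟩, fun χ hχ => ?_, fun χ hχ => ?_⟩
    · rw [ht]
      split_ifs with h1 h2
      · rw [h1]; exact hψ
      · rw [h2, charCoeff_inv, hQinv, Complex.exp_conj, ← map_mul, ← map_mul, hψ]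
        simp
      · simp [h1, h2] at hχ
    · rw [ht]
      simp only [Finset.mem_insert, Finset.mem_singleton, not_or] at hχ
      rw [if_neg hχ.1, if_neg hχ.2]
  unfold HasNonnegRealExpansion at hS
  rw [not_and_or] at hS
  push Not at hS
  -- At a real character only a positive factor exp Z is available, but the coefficient is already
  -- negative. At a complex one Z is unrestricted, so any nonzero coefficient can be rotated to the
  -- negative axis, and the conjugate character follows by conjugation.
  rcases hS with ⟨ψ, hψ, hneg⟩ | ⟨ψ, hψ, hne⟩
  · obtain ⟨r, hr, hQr⟩ := hQreal ψ hψ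
    have hc : charCoeff m S ψ = ((charCoeff m S ψ).re : ℂ) := by
      have := charCoeff_inv S ψ
      rw [hψ.inv_eq] at this
      exact (Complex.conj_eq_iff_re.1 this.symm).symm
    set c := (charCoeff m S ψ).re with hcdef
    refine key ψ (Real.log (W / (-c * r)) : ℝ) (fun _ => Complex.ofReal_im _) ?_
    have hcr : 0 < -c * r := mul_pos (by linarith) hr
    rw [hc, hQr, ← Complex.ofReal_exp, Real.exp_log (div_pos hW hcr)]
    norm_cast
    have : c ≠ 0 := by intro h; rw [h] at hneg; exact lt_irrefl _ hneg
    field_simp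
  · have h0 : charCoeff m S ψ * Q ψ ≠ 0 := mul_ne_zero hne (hQ ψ)
    refine key ψ (Complex.log (-W / (charCoeff m S ψ * Q ψ))) (fun h => absurd h hψ) ?_
    have hW0 : (W : ℂ) ≠ 0 := by exact_mod_cast hW.ne'
    rw [Complex.exp_log (div_ne_zero (neg_ne_zero.2 hW0) h0)]
    generalize charCoeff m S ψ * Q ψ = k at h0 ⊢
    field_simp

/-- Each logarithm differs from z(p) by at most |z(p)|² ≤ 1/p², and these errors sum to at most 2/Y.
-/
theorem prod_one_sub_inv_eq_exp {s : Finset ℕ} (z : ℕ → ℂ) (hz : ∀ p ∈ s, ‖z p‖ ≤ 1 / p)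
    {Y : ℕ} (hY : 2 ≤ Y) {K : ℕ} (hs : ∀ p ∈ s, Y ≤ p ∧ p < K) :
    ∃ r : ℂ, ‖r‖ ≤ 2 / Y ∧ ∏ p ∈ s, (1 - z p)⁻¹ = Complex.exp (∑ p ∈ s, z p + r) := by
  refine ⟨∑ p ∈ s, (Complex.log (1 - z p)⁻¹ - z p), ?_, ?_⟩
  · refine (norm_sum_le _ _).trans ?_
    refine (Finset.sum_le_sum (g := fun p : ℕ => 1 / (p : ℝ) ^ 2) fun p hp => ?_).trans
      ((Finset.sum_le_sum_of_subset_of_nonneg (t := Finset.Ico Y K) (fun p hp =>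
        Finset.mem_Ico.2 (hs p hp)) fun _ _ _ => by positivity).trans
        (sum_Ico_one_div_sq_le (by omega) K))
    have hp2 : (2 : ℝ) ≤ p := by exact_mod_cast hY.trans (hs p hp).1
    have h1 := hz p hp
    have h2 : ‖z p‖ ≤ 1 / 2 := h1.trans (one_div_le_one_div_of_le (by norm_num) hp2)
    refine (Complex.norm_log_one_sub_inv_sub_self_le (by linarith)).trans ?_
    have h3 : (1 - ‖z p‖)⁻¹ ≤ 2 := by
      rw [inv_le_comm₀ (by linarith) (by norm_num)]
      linarith
    have h4 : ‖z p‖ ^ 2 ≤ 1 / (p : ℝ) ^ 2 := by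
      have := pow_le_pow_left₀ (norm_nonneg _) h1 2
      rwa [div_pow, one_pow] at this
    have h5 := mul_le_mul_of_nonneg_left h3 (sq_nonneg ‖z p‖)
    linarith
  · rw [Finset.sum_sub_distrib, add_sub_cancel, Complex.exp_sum]
    refine Finset.prod_congr rfl fun p hp => ?_
    have hp2 : (2 : ℝ) ≤ p := by exact_mod_cast hY.trans (hs p hp).1
    have h2 : ‖z p‖ ≤ 1 / 2 :=
      (hz p hp).trans (one_div_le_one_div_of_le (by norm_num) hp2)
    rw [Complex.exp_log]
    refine inv_ne_zero (sub_ne_zero.2 fun h => ?_)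
    rw [← h, norm_one] at h2
    norm_num at h2

theorem DirichletCharacter.norm_mul_ofReal_div_le {m : ℕ} [NeZero m] (χ : DirichletCharacter ℂ m)
    (a : ZMod m) {e : ℝ} (he : e = 1 ∨ e = -1) (p : ℕ) : ‖χ a * (e : ℂ) / p‖ ≤ 1 / p := by
  have h : |e| = 1 := by rcases he with h | h <;> rw [h] <;> simp
  rw [norm_div, norm_mul, Complex.norm_real, Real.norm_eq_abs, h, mul_one, Complex.norm_natCast]
  exact div_le_div_of_nonneg_right (χ.norm_le_one _) (Nat.cast_nonneg p)

/-- The primes in `[Y, K)` that belong to the residue class `a`. -/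
def primesInClass {m : ℕ} (Y K : ℕ) (a : ZMod m) : Finset ℕ :=
  (Finset.Ico Y K).filter fun p : ℕ => p.Prime ∧ (p : ZMod m) = a

/-- For targets on the invertible residue classes, the signs at the primes in some interval
`[Y, K)` can be chosen such that the Euler products over these primes are close to the
exponentials of the Fourier coefficients of the targets. -/
theorem exists_signs_prod_eq_exp {m : ℕ} [NeZero m] {Y : ℕ} (hY : 2 ≤ Y) (t : ZMod m → ℝ) :
    ∀ᶠ K in atTop, ∃ e : ℕ → ℝ, (∀ p, e p = 1 ∨ e p = -1) ∧
      ∀ χ : DirichletCharacter ℂ m, ∃ r : ℂ, ‖r‖ ≤ (m + 2) / Y ∧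
        ∏ p ∈ Finset.Ico Y K with p.Prime, (1 - χ p * (e p : ℂ) / p)⁻¹ =
          Complex.exp (∑ a : ZMod m, χ a * (t a : ℂ) + r) := by
  classical
  have hY0 : (0 : ℝ) < Y := by exact_mod_cast (show 0 < Y by omega)
  have hdiv : ∀ a : ZMod m, IsUnit a → ∀ᶠ K in atTop,
      |t a| ≤ ∑ p ∈ primesInClass Y K a, 1 / (p : ℝ) := by
    intro a ha
    have h := (not_summable_iff_tendsto_nat_atTop_of_nonneg fun n => by
      split_ifs <;> positivity).1 (not_summable_one_div_primes_residueClass ha)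
    filter_upwards [h.eventually_ge_atTop (|t a| + ∑ n ∈ Finset.range Y,
      if n.Prime ∧ (n : ZMod m) = a then 1 / (n : ℝ) else 0), eventually_ge_atTop Y] with K hK hYK
    rw [primesInClass, Finset.sum_filter, Finset.sum_Ico_eq_sub _ hYK]
    linarith
  have hall : ∀ᶠ K in atTop, ∀ a : ZMod m, IsUnit a →
      |t a| ≤ ∑ p ∈ primesInClass Y K a, 1 / (p : ℝ) := by
    refine eventually_all.2 fun a => ?_
    by_cases ha : IsUnit a
    · filter_upwards [hdiv a ha] with K hK _ using hK
    · exact Eventually.of_forall fun K h => absurd h ha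
  filter_upwards [hall] with K hK
  -- The greedy signs are chosen in each class separately. Once the class has enough mass the error
  -- is at most 1/Y, so the m classes and the logarithmic error 2/Y give (m + 2)/Y.
  choose e he hle using fun a : ZMod m => exists_signs_abs_sub_sum_le
    (primesInClass Y K a) (fun p : ℕ => 1 / (p : ℝ))
    (B := 1 / Y) (fun p hp => ⟨by positivity, by
      rw [primesInClass, Finset.mem_filter, Finset.mem_Ico] at hp
      exact one_div_le_one_div_of_le hY0 (by exact_mod_cast hp.1.1)⟩) (t a)
  refine ⟨fun p => e (p : ZMod m) p, fun p => he _ p, fun χ => ?_⟩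
  obtain ⟨r, hr, hprod⟩ := prod_one_sub_inv_eq_exp (s := {p ∈ Finset.Ico Y K | p.Prime})
    (fun p => χ p * (e (p : ZMod m) p : ℂ) / p)
    (fun p _ => χ.norm_mul_ofReal_div_le _ (he _ p) p) hY
    (fun p hp => Finset.mem_Ico.1 (Finset.mem_filter.1 hp).1)
  have hsum : ∑ p ∈ Finset.Ico Y K with p.Prime, χ p * (e (p : ZMod m) p : ℂ) / p =
      ∑ a : ZMod m, χ a * ((∑ p ∈ primesInClass Y K a,
        e a p * (1 / (p : ℝ)) : ℝ) : ℂ) := by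
    rw [← Finset.sum_fiberwise_of_maps_to (g := fun p : ℕ => (p : ZMod m)) (t := Finset.univ)
      fun _ _ => Finset.mem_univ _]
    refine Finset.sum_congr rfl fun a _ => ?_
    rw [Finset.filter_filter]
    change ∑ p ∈ primesInClass Y K a, _ = _
    push_cast
    rw [Finset.mul_sum]
    refine Finset.sum_congr rfl fun p hp => ?_
    rw [primesInClass, Finset.mem_filter] at hp
    rw [hp.2.2]
    ring
  refine ⟨∑ a : ZMod m, χ a * ((∑ p ∈ primesInClass Y K a,
    e a p * (1 / (p : ℝ)) - t a : ℝ) : ℂ) + r, ?_, ?_⟩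
  · have hb : ∀ a : ZMod m, ‖χ a * ((∑ p ∈ primesInClass Y K a,
        e a p * (1 / (p : ℝ)) - t a : ℝ) : ℂ)‖ ≤ 1 / Y := by
      intro a
      by_cases ha : IsUnit a
      · rw [norm_mul, Complex.norm_real, Real.norm_eq_abs, abs_sub_comm]
        have h1 := (hle a).trans (max_le le_rfl
          ((sub_nonpos.2 (hK a ha)).trans (by positivity)))
        calc _ ≤ 1 * (1 / (Y : ℝ)) :=
              mul_le_mul (χ.norm_le_one _) h1 (abs_nonneg _) zero_le_one
          _ = _ := one_mul _
      · rw [χ.map_nonunit ha, zero_mul, norm_zero]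
        positivity
    refine (norm_add_le _ _).trans ((add_le_add ((norm_sum_le _ _).trans
      (Finset.sum_le_sum fun a _ => hb a)) hr).trans (le_of_eq ?_))
    rw [Finset.sum_const, Finset.card_univ, ZMod.card, nsmul_eq_mul]
    ring
  · rw [hprod, hsum]
    congr 1
    rw [← add_assoc, ← Finset.sum_add_distrib]
    congr 1
    refine Finset.sum_congr rfl fun a _ => ?_
    push_cast
    ring

/-- If the expansion of `S` has a negative real coefficient or a non-zero complex one, then the
signs at the primes can be chosen such that the corresponding combination of Euler products is
bounded away from zero and negative. -/
theorem exists_signs_eulerCombination_re_le {m : ℕ} [NeZero m] {S : Finset (ZMod m)ˣ}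
    (hS : ¬ HasNonnegRealExpansion m S) :
    ∀ᶠ K in atTop, ∃ e : ℕ → ℝ, (∀ p, e p = 1 ∨ e p = -1) ∧
      (eulerCombination m S e K).re ≤ -1 := by
  classical
  -- This makes every error r at most 1/4, hence |exp r - 1| ≤ 1/2.
  set Y := 4 * (m + 2) with hY
  have hfac : ∀ (χ : DirichletCharacter ℂ m), ∀ p ∈ Y.primesBelow, 1 - χ p / p ≠ 0 := by
    intro χ p hp h
    rw [Nat.mem_primesBelow] at hp
    have h1 := χ.norm_mul_ofReal_div_le (p : ZMod m) (Or.inl rfl) p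
    rw [Complex.ofReal_one, mul_one, ← sub_eq_zero.1 h, norm_one,
      le_div_iff₀ (by exact_mod_cast hp.2.pos), one_mul] at h1
    exact absurd hp.2.one_lt (not_lt.2 (by exact_mod_cast h1))
  set Q : DirichletCharacter ℂ m → ℂ := fun χ => ∏ p ∈ Y.primesBelow, (1 - χ p / p)⁻¹ with hQ
  set C := ∑ χ : DirichletCharacter ℂ m, ‖charCoeff m S χ * Q χ‖ with hC
  have hC0 : 0 ≤ C := Finset.sum_nonneg fun _ _ => norm_nonneg _
  -- With W = 2(1 + 2C), each term in `T` has real part at most -W/2 = -(1 + 2C), while all others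
  -- together add at most 2C.
  obtain ⟨t, T, hT, hTW, hT0⟩ := exists_real_weights_of_not_hasNonnegRealExpansion hS Q
    (fun χ => Finset.prod_ne_zero_iff.2 fun p hp => inv_ne_zero (hfac χ p hp))
    (fun χ => by
      simp only [hQ, map_prod, map_inv₀, map_sub, map_one, map_div₀, map_natCast,
        DirichletCharacter.inv_apply_eq_conj])
    (fun χ hχ => by
      refine ⟨∏ p ∈ Y.primesBelow, (1 - (χ p).re / p)⁻¹, Finset.prod_pos fun p hp => ?_, ?_⟩
      · rw [Nat.mem_primesBelow] at hp
        have hp1 : (1 : ℝ) < p := by exact_mod_cast hp.2.one_lt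
        refine inv_pos.2 (sub_pos.2 ((div_lt_one (by linarith)).2 (lt_of_le_of_lt ?_ hp1)))
        exact (Complex.re_le_norm _).trans (χ.norm_le_one _)
      · rw [hQ]
        push_cast
        refine Finset.prod_congr rfl fun p _ => ?_
        rw [show χ (p : ZMod m) = ((χ (p : ZMod m)).re : ℂ) from
          Complex.ext rfl (by simpa using hχ p)]
        simp)
    (W := 2 * (1 + 2 * C)) (by positivity)
  filter_upwards [exists_signs_prod_eq_exp (Y := Y) (by omega) t, eventually_ge_atTop Y]
    with K hK hYK
  obtain ⟨e, he, hprod⟩ := hK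
  choose r hr hprod using hprod
  refine ⟨fun p => if p < Y then 1 else e p, fun p => ?_, ?_⟩
  · by_cases h : p < Y
    · exact Or.inl (if_pos h)
    · simpa only [if_neg h] using he p
  have hr1 : ∀ χ, ‖r χ‖ ≤ 1 / 4 := by
    intro χ
    refine (hr χ).trans (le_of_eq ?_)
    rw [hY]
    push_cast
    field_simp
  have hexp : ∀ χ, ‖Complex.exp (r χ) - 1‖ ≤ 1 / 2 := by
    intro χ
    have := Complex.norm_exp_sub_one_le ((hr1 χ).trans (by norm_num))
    linarith [hr1 χ]
  have hsplit : ∀ χ : DirichletCharacter ℂ m, ∏ p ∈ K.primesBelow,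
      (1 - χ p * ((if p < Y then 1 else e p : ℝ) : ℂ) / p)⁻¹ =
        Q χ * Complex.exp (∑ a : ZMod m, χ a * (t a : ℂ) + r χ) := by
    intro χ
    have hsub : Y.primesBelow ⊆ K.primesBelow := by
      intro p hp
      rw [Nat.mem_primesBelow] at hp ⊢
      exact ⟨hp.1.trans_le hYK, hp.2⟩
    rw [← Finset.prod_sdiff hsub, mul_comm, ← hprod]
    congr 1
    · refine Finset.prod_congr rfl fun p hp => ?_
      rw [if_pos (Nat.mem_primesBelow.1 hp).1, Complex.ofReal_one, mul_one]
    · have hset : K.primesBelow \ Y.primesBelow = {p ∈ Finset.Ico Y K | p.Prime} := by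
        ext p
        simp only [Finset.mem_sdiff, Nat.mem_primesBelow, Finset.mem_filter, Finset.mem_Ico]
        constructor
        · rintro ⟨⟨h1, h2⟩, h3⟩
          exact ⟨⟨not_lt.1 fun h => h3 ⟨h, h2⟩, h1⟩, h2⟩
        · rintro ⟨⟨h1, h2⟩, h3⟩
          exact ⟨⟨h2, h3⟩, fun h => absurd h.1 (not_lt.2 h1)⟩
      rw [hset]
      refine Finset.prod_congr rfl fun p hp => ?_
      rw [Finset.mem_filter, Finset.mem_Ico] at hp
      rw [if_neg (not_lt.2 hp.1.1)]
  unfold eulerCombination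
  simp only [hsplit]
  rw [Complex.re_sum, ← Finset.sum_add_sum_compl T]
  have hin : ∀ χ ∈ T, (charCoeff m S χ * (Q χ * Complex.exp (∑ a : ZMod m, χ a * (t a : ℂ)
      + r χ))).re ≤ -(1 + 2 * C) := by
    intro χ hχ
    rw [Complex.exp_add, ← mul_assoc, ← mul_assoc, hTW χ hχ, ← Complex.ofReal_neg,
      Complex.re_ofReal_mul]
    have h1 := (abs_le.1 ((Complex.abs_re_le_norm _).trans (hexp χ))).1
    rw [Complex.sub_re, Complex.one_re] at h1
    nlinarith
  have hout : ∀ χ ∈ Tᶜ, (charCoeff m S χ * (Q χ * Complex.exp (∑ a : ZMod m, χ a * (t a : ℂ)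
      + r χ))).re ≤ 2 * ‖charCoeff m S χ * Q χ‖ := by
    intro χ hχ
    rw [hT0 χ (Finset.mem_compl.1 hχ), zero_add, ← mul_assoc]
    refine (Complex.re_le_norm _).trans ?_
    rw [norm_mul, mul_comm]
    refine mul_le_mul_of_nonneg_right ?_ (norm_nonneg _)
    calc ‖Complex.exp (r χ)‖ = ‖(Complex.exp (r χ) - 1) + 1‖ := by rw [sub_add_cancel]
      _ ≤ ‖Complex.exp (r χ) - 1‖ + ‖(1 : ℂ)‖ := norm_add_le _ _
      _ ≤ 2 := by rw [norm_one]; linarith [hexp χ]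
  have h1 := Finset.sum_le_sum hin
  have h2 := Finset.sum_le_sum hout
  rw [Finset.sum_const, nsmul_eq_mul] at h1
  rw [← Finset.mul_sum] at h2
  have h3 : ∑ χ ∈ Tᶜ, ‖charCoeff m S χ * Q χ‖ ≤ C :=
    Finset.sum_le_sum_of_subset_of_nonneg (Finset.subset_univ _) fun _ _ _ => norm_nonneg _
  have h4 : (1 : ℝ) ≤ T.card := by exact_mod_cast hT.card_pos
  nlinarith

/-! ### Assembly of the two cases. -/

theorem prod_primesBelow_one_sub_one_div_inv_le {H : ℝ} (hH : 1 ≤ H) {N : ℕ}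
    (hN : (N : ℝ) ≤ Real.exp H) :
    ∏ p ∈ N.primesBelow, (1 - 1 / (p : ℝ))⁻¹ ≤ Real.exp 56 * H ^ 28 := by
  have h := prod_primesBelow_one_sub_rpow_inv_le hH hN le_rfl (by norm_num) (by norm_num)
  simpa only [zero_sub, Real.rpow_neg_one, one_div] using h

theorem sum_smoothNumbers_one_div_le (X N : ℕ) :
    ∑ a ∈ Finset.Ico 1 X with a ∈ Nat.smoothNumbers N, 1 / (a : ℝ)
      ≤ ∏ p ∈ N.primesBelow, (1 - 1 / (p : ℝ))⁻¹ := by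
  classical
  have h := hasSum_indicator_smoothNumbers_rpow (show (0 : ℝ) < 1 by norm_num) N
  simp only [zero_sub, Real.rpow_neg_one, ← one_div] at h
  have h1 := sum_le_hasSum {a ∈ Finset.Ico 1 X | a ∈ Nat.smoothNumbers N}
    (fun n _ => Set.indicator_nonneg (fun _ _ => by positivity) n) h
  refine le_trans (le_of_eq (Finset.sum_congr rfl fun n hn => ?_)) (h1.trans (le_of_eq ?_))
  · rw [Set.indicator_of_mem (Finset.mem_filter.1 hn).2]
  · simp only [one_div]

theorem eulerCombination_congr {m : ℕ} [NeZero m] (S : Finset (ZMod m)ˣ) {g g' : ℕ → ℝ} {N : ℕ}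
    (h : ∀ p ∈ N.primesBelow, g p = g' p) :
    eulerCombination m S g N = eulerCombination m S g' N := by
  unfold eulerCombination
  refine Finset.sum_congr rfl fun χ _ => ?_
  congr 1
  exact Finset.prod_congr rfl fun p hp => by rw [h p hp]

theorem sum_Ico_ceil_one_div_le {x : ℝ} (hx : 3 ≤ x) :
    ∑ n ∈ Finset.Ico 1 ⌈x⌉₊, 1 / (n : ℝ) ≤ 3 * Real.log x := by
  have h1 : ∑ n ∈ Finset.Ico 1 ⌈x⌉₊, 1 / (n : ℝ) ≤ ((harmonic ⌈x⌉₊ : ℚ) : ℝ) := by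
    rw [harmonic_eq_sum_Icc]
    push_cast
    simp only [one_div]
    refine Finset.sum_le_sum_of_subset_of_nonneg (fun n hn => ?_) fun _ _ _ => by positivity
    rw [Finset.mem_Ico] at hn
    exact Finset.mem_Icc.2 ⟨hn.1, hn.2.le⟩
  have h2 := harmonic_le_one_add_log ⌈x⌉₊
  have h3 : (⌈x⌉₊ : ℝ) < x + 1 := Nat.ceil_lt_add_one (by linarith)
  have h4 : Real.log ⌈x⌉₊ ≤ 2 * Real.log x := by
    have : 2 * Real.log x = Real.log (x ^ 2) := by rw [Real.log_pow]; norm_num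
    rw [this]
    refine Real.log_le_log (by exact_mod_cast Nat.ceil_pos.2 (by linarith)) ?_
    nlinarith
  have h5 : 1 ≤ Real.log x := by
    rw [Real.le_log_iff_exp_le (by linarith)]
    linarith [Real.exp_one_lt_d9]
  linarith

namespace IsRandomCompletelyMultiplicative

variable {Ω : Type*} [MeasurableSpace Ω] {P : Measure Ω} {f : Ω → (ℕ →*₀ ℝ)}

theorem measure_prescribed_signs_pos (hf : IsRandomCompletelyMultiplicative P f) (N : ℕ)
    {e : ℕ → ℝ} (he : ∀ p, e p = 1 ∨ e p = -1) :
    MeasurableSet[primesSigma f {p | (p : ℕ) < N}] {ω | ∀ p ∈ N.primesBelow, f ω p = e p} ∧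
      0 < P {ω | ∀ p ∈ N.primesBelow, f ω p = e p} := by
  have hset : {ω | ∀ p ∈ N.primesBelow, f ω p = e p} =
      ⋂ p ∈ (Finset.subtype Nat.Prime N.primesBelow : Finset Nat.Primes),
        (fun ω => f ω (p : ℕ)) ⁻¹' {e p} := by
    ext ω
    simp only [Set.mem_ofPred_eq, Set.mem_iInter, Finset.mem_subtype, Set.mem_preimage,
      Set.mem_singleton_iff]
    exact ⟨fun h p hp => h p hp, fun h p hp => h ⟨p, (Nat.mem_primesBelow.1 hp).2⟩ hp⟩
  rw [hset]
  constructor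
  · refine Finset.measurableSet_biInter _ fun p hp => ?_
    refine measurable_primesSigma f _ p p.2.ne_zero (fun q hq => ?_) (measurableSet_singleton _)
    rw [(Nat.prime_dvd_prime_iff_eq q.2 p.2).1 hq |> Subtype.ext]
    exact (Nat.mem_primesBelow.1 (Finset.mem_subtype.1 hp)).1
  · have hprod := hf.indep.measure_inter_preimage_eq_mul
      (Finset.subtype Nat.Prime N.primesBelow : Finset Nat.Primes)
      (sets := fun p => {e p}) fun p _ => measurableSet_singleton _
    refine lt_of_lt_of_eq ?_ hprod.symm
    refine (Finset.prod_ne_zero_iff.2 fun p _ => ?_).bot_lt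
    rcases he p with h | h <;> rw [h]
    · exact (hf.prob_one p).trans_ne (by simp)
    · exact (hf.prob_neg_one p).trans_ne (by simp)

variable [IsProbabilityMeasure P]

theorem exists_pos_eventually_lt_measure_of_not_hasNonnegRealExpansion
    (hf : IsRandomCompletelyMultiplicative P f) {m : ℕ} [NeZero m] {S : Finset (ZMod m)ˣ}
    (hS : ¬ HasNonnegRealExpansion m S) :
    ∃ δ : ℝ, 0 < δ ∧ ∀ᶠ x : ℝ in atTop,
      δ < P.real {ω | residuePartialSum m S (fun n => f ω n) x < 0} := by
  classical
  -- The product is O((log N)^28), so its square is o(N). The value 1/16 is a quarter of (1/2)², so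
  -- Chebyshev's inequality at height 1/2 loses at most a quarter of P(E).
  have hlog : ∀ᶠ N : ℕ in atTop,
      12 * (∏ p ∈ N.primesBelow, (1 - 1 / (p : ℝ))⁻¹) ^ 2 / N ≤ 1 / 16 := by
    have hc : (0 : ℝ) < 1 / (16 * 12 * Real.exp 56 ^ 2) := by positivity
    have h := ((Real.isLittleO_pow_log_id_atTop (n := 56)).def hc).natCast_atTop
    filter_upwards [h, eventually_ge_atTop 3] with N hN hN3
    have hN3' : (3 : ℝ) ≤ N := by exact_mod_cast hN3
    have hN0 : (0 : ℝ) < N := by linarith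
    have hl : 1 ≤ Real.log N := by
      rw [Real.le_log_iff_exp_le hN0]
      linarith [Real.exp_one_lt_d9]
    have hL := prod_primesBelow_one_sub_one_div_inv_le hl (Real.exp_log hN0).ge
    have hL0 : 0 ≤ ∏ p ∈ N.primesBelow, (1 - 1 / (p : ℝ))⁻¹ := by
      refine Finset.prod_nonneg fun p hp => inv_nonneg.2 (sub_nonneg.2 ?_)
      have := (Nat.mem_primesBelow.1 hp).2.one_lt
      rw [div_le_one (by exact_mod_cast this.trans' one_pos)]
      exact_mod_cast this.le
    have hL2 := pow_le_pow_left₀ hL0 hL 2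
    simp only [id, Real.norm_eq_abs] at hN
    rw [abs_of_nonneg (by positivity), abs_of_pos hN0] at hN
    rw [div_le_iff₀ hN0]
    have e1 : (Real.exp 56 * Real.log N ^ 28) ^ 2 = Real.exp 56 ^ 2 * Real.log N ^ 56 := by ring
    rw [e1] at hL2
    have h3 := mul_le_mul_of_nonneg_left hN (sq_nonneg (Real.exp 56))
    have e2 : Real.exp 56 ^ 2 * (1 / (16 * 12 * Real.exp 56 ^ 2) * (N : ℝ)) = N / (16 * 12) := by
      field_simp
    rw [e2] at h3
    linarith
  obtain ⟨N, hN, ⟨e, he, hM⟩, hN0⟩ := ((hlog.and ((exists_signs_eulerCombination_re_le hS).and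
    (eventually_ge_atTop 1))).exists)
  set L := ∏ p ∈ N.primesBelow, (1 - 1 / (p : ℝ))⁻¹ with hL
  set E := {ω | ∀ p ∈ N.primesBelow, f ω p = e p} with hE
  obtain ⟨hEm, hEpos⟩ := hf.measure_prescribed_signs_pos N he
  have hEr : 0 < P.real E := ENNReal.toReal_pos hEpos.ne' (measure_ne_top _ _)
  -- A sample point of `E` supplies the completely multiplicative `g` required by the mean-square
  -- bound.
  obtain ⟨ω₀, hω₀E, hω₀⟩ : ∃ ω ∈ E, ∀ p : ℕ, p.Prime → f ω p = 1 ∨ f ω p = -1 := by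
    by_contra hcon
    push Not at hcon
    refine hEpos.ne' (measure_mono_null (fun ω hω => ?_) (ae_iff.1 hf.ae_eq_one_or_neg_one))
    obtain ⟨p, hp, h⟩ := hcon ω hω
    exact fun hall => (hall p hp).elim h.1 h.2
  refine ⟨P.real E / 2, by positivity, ?_⟩
  -- Now `N` is fixed, so a fixed exponent such as α = 1/2 sends the truncation error to 0. The
  -- final budget is -1 + 1/4 + 1/2 < 0.
  have htend : Tendsto (fun x : ℝ => ((⌈x⌉₊ : ℕ) : ℝ) ^ (-(1 / 2) : ℝ) *
      ∏ p ∈ N.primesBelow, (1 - (p : ℝ) ^ ((1 / 2 : ℝ) - 1))⁻¹) atTop (nhds 0) := by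
    rw [← zero_mul (∏ p ∈ N.primesBelow, (1 - (p : ℝ) ^ ((1 / 2 : ℝ) - 1))⁻¹)]
    exact ((tendsto_rpow_neg_atTop (by norm_num)).comp
      (tendsto_natCast_atTop_atTop.comp tendsto_nat_ceil_atTop)).mul_const _
  filter_upwards [htend.eventually_le_const (show (0 : ℝ) < 1 / 4 by norm_num),
    eventually_gt_atTop 0] with x hx hx0
  set X := ⌈x⌉₊ with hX
  have hX0 : 0 < X := Nat.ceil_pos.2 hx0
  set A := residueSet m S with hA
  obtain ⟨hint, hsq⟩ := hf.integral_indicator_mul_sq_le A (X := X) (by omega)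
    (sum_smoothNumbers_one_div_le X N) hω₀ hEm
    (fun ω hω p hp => (hω p hp).trans (hω₀E p hp).symm)
  set U := {ω | 1 / 4 ≤ E.indicator (fun _ => (1 : ℝ)) ω *
      (smoothPartialSum A (f ω) X X - smoothPartialSum A (f ω) X N) ^ 2} with hU
  have hmk := mul_meas_ge_le_integral_of_nonneg (Eventually.of_forall fun ω =>
    mul_nonneg (Set.indicator_nonneg (fun _ _ => zero_le_one) ω) (sq_nonneg _)) hint (1 / 4)
  have hUle : P.real U ≤ P.real E / 4 := by
    have h1 := mul_le_mul_of_nonneg_left hN hEr.le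
    have h2 : 1 / 4 * P.real U ≤ P.real E * (1 / 16) := hmk.trans (hsq.trans h1)
    linarith
  have hsub : E ≤ᵐ[P] (U ∪ {ω | residuePartialSum m S (fun n => f ω n) x < 0} : Set Ω) := by
    filter_upwards [hf.ae_eq_one_or_neg_one] with ω hω hωE
    by_cases hωU : ω ∈ U
    · exact Or.inl hωU
    refine Or.inr ?_
    change residuePartialSum m S (fun n => f ω n) x < 0
    rw [residuePartialSum_eq_smoothPartialSum m S _ x le_rfl]
    rw [hU, Set.mem_ofPred_eq, not_le, Set.indicator_of_mem hωE, one_mul] at hωU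
    have h1 : smoothPartialSum A (f ω) X X - smoothPartialSum A (f ω) X N < 1 / 2 :=
      lt_of_pow_lt_pow_left₀ 2 (by norm_num) (hωU.trans_eq (by norm_num))
    have h2 := (abs_le.1 (abs_smoothPartialSum_sub_le S (f ω) (abs_le_one_of_primes hω) hX0 N
      (α := 1 / 2) (by norm_num) (by norm_num))).2
    rw [eulerCombination_congr S (g := f ω) (g' := e) hωE] at h2
    linarith
  have hle : P.real E ≤ P.real U +
      P.real {ω | residuePartialSum m S (fun n => f ω n) x < 0} :=
    (ENNReal.toReal_mono (measure_ne_top _ _) (measure_mono_ae hsub)).trans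
      (measureReal_union_le _ _)
  linarith

theorem isBigO_measure_of_hasNonnegRealExpansion
    (hf : IsRandomCompletelyMultiplicative P f) {m : ℕ} [NeZero m] {S : Finset (ZMod m)ˣ}
    (hSne : S.Nonempty) (hS : HasNonnegRealExpansion m S) :
    (fun x : ℝ => P.real {ω | residuePartialSum m S (fun n => f ω n) x < 0}) =O[atTop]
      (fun x : ℝ => Real.exp (-Real.exp (Real.log x / (114 * Real.log (Real.log x))))) := by
  have hφ : (0 : ℝ) < m.totient := by
    exact_mod_cast Nat.totient_pos.2 (Nat.pos_of_ne_zero (NeZero.ne m))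
  have hφ1 : (1 : ℝ) ≤ m.totient := by
    exact_mod_cast Nat.totient_pos.2 (Nat.pos_of_ne_zero (NeZero.ne m))
  set c : ℝ := 1 / m.totient / Real.exp 56 with hc
  have hc0 : 0 < c := by positivity
  have hc1 : c ≤ 1 := by
    rw [hc, div_div, div_le_one (by positivity)]
    exact one_le_mul_of_one_le_of_one_le hφ1 (Real.one_le_exp (by norm_num))
  -- The last condition gives H ≥ 118 log v, that is exp(H/2) ≥ v^59: 58 powers for t²/v², with t of
  -- order v^(-28), and one for the constant 288/c².
  have hev : ∀ᶠ v : ℝ in atTop, 1 ≤ Real.log v ∧ Real.log (288 / c ^ 2) ≤ Real.log v ∧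
      2 * Real.exp 56 / c ≤ v ∧ 114 * 59 * Real.log v ^ 2 ≤ v := by
    have h := (Real.isLittleO_pow_log_id_atTop (n := 2)).def
      (show (0 : ℝ) < 1 / (114 * 59) by norm_num)
    filter_upwards [Real.tendsto_log_atTop.eventually_ge_atTop 1,
      Real.tendsto_log_atTop.eventually_ge_atTop (Real.log (288 / c ^ 2)),
      eventually_ge_atTop (2 * Real.exp 56 / c), h, eventually_ge_atTop 0]
      with v h1 h2 h3 h4 h5
    refine ⟨h1, h2, h3, ?_⟩
    simp only [id, Real.norm_eq_abs] at h4
    rw [abs_of_nonneg (by positivity), abs_of_nonneg h5] at h4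
    linarith
  refine IsBigO.of_bound (Real.exp 1) ?_
  filter_upwards [Real.tendsto_log_atTop.eventually hev, eventually_ge_atTop 3] with x hx hx3
  obtain ⟨hw1, hwc, hvc, hvw⟩ := hx
  set v := Real.log x with hv
  set w := Real.log v with hw
  have hx0 : 0 < x := by linarith
  have hv0 : 0 < v := by nlinarith
  have hvexp : Real.exp w = v := Real.exp_log hv0
  have hv1 : 1 ≤ v := by nlinarith
  -- With α = 1/H this gives x^(-α) = v^(-57), where 57 = 28 + 28 + 1: one 28 cancels the Rankin
  -- product, one matches the size of t, and the spare power absorbs constants. The final 114 is 2 ·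
  -- 57.
  set H := v / (57 * w) with hH
  have hw0 : 0 < w := by linarith
  have hH118 : 118 * w ≤ H := by
    rw [hH, le_div_iff₀ (by positivity)]
    linarith
  have hH4 : 4 ≤ H := by linarith
  have hH0 : 0 < H := by linarith
  have hHv : H ≤ v := by
    rw [hH, div_le_iff₀ (by positivity)]
    nlinarith
  set N := ⌊Real.exp H⌋₊ with hN
  have hNle : (N : ℝ) ≤ Real.exp H := Nat.floor_le (Real.exp_pos _).le
  have hNge : Real.exp H / 2 ≤ N := by
    have h1 : Real.exp H < N + 1 := Nat.lt_floor_add_one _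
    have h2 := Real.add_one_le_exp H
    linarith
  have hN0 : 0 < N := by
    have : (0 : ℝ) < N := lt_of_lt_of_le (by positivity) hNge
    exact_mod_cast this
  set X := ⌈x⌉₊ with hX
  have hX0 : 0 < X := Nat.ceil_pos.2 hx0
  set A := residueSet m S with hA
  set t := c / 2 / v ^ 28 with ht
  have ht0 : 0 < t := by positivity
  have hv28 : 1 ≤ v ^ 28 := one_le_pow₀ hv1
  have ht1 : t ≤ 1 := by
    rw [ht, div_le_one (by positivity)]
    linarith
  have hαH : 1 / H * H = 1 := by field_simp
  have htrunc : (X : ℝ) ^ (-(1 / H)) * ∏ p ∈ N.primesBelow, (1 - (p : ℝ) ^ (1 / H - 1))⁻¹ ≤ t := by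
    have h1 := prod_primesBelow_one_sub_rpow_inv_le (by linarith) hNle (α := 1 / H)
      (by positivity) (one_div_le_one_div_of_le (by norm_num) hH4) hαH.le
    have h2 : (X : ℝ) ^ (-(1 / H)) ≤ 1 / v ^ 57 := by
      have h3 : (X : ℝ) ^ (-(1 / H)) ≤ x ^ (-(1 / H)) :=
        Real.rpow_le_rpow_of_nonpos hx0 (Nat.le_ceil x) (by
          have : 0 < 1 / H := by positivity
          linarith)
      refine h3.trans (le_of_eq ?_)
      have e1 : v * -(1 / H) = -(w * (57 : ℕ)) := by
        rw [hH]
        push_cast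
        field_simp
      rw [Real.rpow_def_of_pos hx0, ← hv, e1, Real.exp_neg, Real.exp_mul, hvexp,
        Real.rpow_natCast, one_div]
    have h4 : H ^ 28 ≤ v ^ 28 := pow_le_pow_left₀ hH0.le hHv 28
    calc _ ≤ 1 / v ^ 57 * (Real.exp 56 * v ^ 28) := by
          refine mul_le_mul h2 (h1.trans (mul_le_mul_of_nonneg_left h4 (Real.exp_pos _).le))
            (Finset.prod_nonneg fun p hp => inv_nonneg.2 (sub_nonneg.2
              (Real.rpow_le_one_of_one_le_of_nonpos ?_ ?_))) (by positivity)
          · exact_mod_cast (Nat.mem_primesBelow.1 hp).2.one_lt.le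
          · have : 1 / H ≤ 1 := (div_le_one hH0).2 (by linarith)
            linarith
      _ = Real.exp 56 / v / v ^ 28 := by field_simp
      _ ≤ t := by
          refine div_le_div_of_nonneg_right ?_ (by positivity)
          rw [div_le_iff₀ hc0] at hvc
          rw [div_le_iff₀ hv0]
          linarith
  have hmain : ∀ g : ℕ →*₀ ℝ, (∀ n, |g n| ≤ 1) → t ≤ smoothPartialSum A g X N := by
    intro g hg
    have h1 := (abs_le.1 (abs_smoothPartialSum_sub_le S g hg hX0 N (α := 1 / H) (by positivity)
      ((div_lt_one hH0).2 (by linarith)))).1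
    have h2 := eulerCombination_re_ge hSne hS hg N
    have h3 := prod_primesBelow_one_sub_one_div_inv_le (by linarith) hNle
    have h4 : H ^ 28 ≤ v ^ 28 := pow_le_pow_left₀ hH0.le hHv 28
    have hpos : 0 < ∏ p ∈ N.primesBelow, (1 - 1 / (p : ℝ))⁻¹ := by
      refine Finset.prod_pos fun p hp => inv_pos.2 (sub_pos.2 ?_)
      have := (Nat.mem_primesBelow.1 hp).2.one_lt
      rw [div_lt_one (by exact_mod_cast this.trans' one_pos)]
      exact_mod_cast this
    -- The trivial character gives at least 2t, of which truncation takes at most t.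
    have h5 : 2 * t ≤ (1 / (m.totient : ℝ)) / ∏ p ∈ N.primesBelow, (1 - 1 / (p : ℝ))⁻¹ := by
      calc 2 * t = (1 / (m.totient : ℝ)) / (Real.exp 56 * v ^ 28) := by
            rw [ht, hc]
            field_simp
        _ ≤ _ := div_le_div_of_nonneg_left (by positivity) hpos
            (h3.trans (mul_le_mul_of_nonneg_left h4 (Real.exp_pos _).le))
    linarith
  -- Taking max X N as the upper level avoids comparing `N` with `X`.
  have hsub : {ω | residuePartialSum m S (fun n => f ω n) x < 0} ≤ᵐ[P]
      {ω | smoothPartialSum A (f ω) X (max X N) - smoothPartialSum A (f ω) X N ≤ -t} := by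
    filter_upwards [hf.ae_eq_one_or_neg_one] with ω hω hneg
    change residuePartialSum m S (fun n => f ω n) x < 0 at hneg
    change smoothPartialSum A (f ω) X (max X N) - smoothPartialSum A (f ω) X N ≤ -t
    rw [residuePartialSum_eq_smoothPartialSum m S _ x (le_max_left X N)] at hneg
    have := hmain (f ω) (abs_le_one_of_primes hω)
    linarith
  have htail := hf.measure_smoothPartialSum_sub_le_le A X hN0 (le_max_right X N)
    (h := 3 * v) (by linarith) (sum_Ico_ceil_one_div_le hx3) ht0.le ht1
  have hP := (ENNReal.toReal_mono (measure_ne_top _ _) (measure_mono_ae hsub)).trans htail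
  rw [Real.norm_of_nonneg measureReal_nonneg, Real.norm_of_nonneg (Real.exp_pos _).le]
  refine hP.trans (mul_le_mul_of_nonneg_left (Real.exp_le_exp.2 (neg_le_neg ?_))
    (Real.exp_pos _).le)
  have e1 : v / (114 * w) = H / 2 := by rw [hH]; field_simp; norm_num
  rw [e1]
  have e2 : t ^ 2 * N / (4 * (3 * v) ^ 2) = c ^ 2 / 144 / v ^ 58 * N := by
    rw [ht]
    field_simp
    norm_num
  rw [e2]
  have h6 : 288 / c ^ 2 * v ^ 58 ≤ Real.exp (H / 2) := by
    rw [← Real.exp_log (show 0 < 288 / c ^ 2 by positivity), ← hvexp, ← Real.exp_nat_mul,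
      ← Real.exp_add]
    refine Real.exp_le_exp.2 ?_
    push_cast
    linarith
  have h7 : Real.exp H = Real.exp (H / 2) * Real.exp (H / 2) := by
    rw [← Real.exp_add, add_halves]
  have h8 : 1 ≤ c ^ 2 / 288 / v ^ 58 * Real.exp (H / 2) := by
    rw [div_div, div_mul_eq_mul_div, one_le_div (by positivity)]
    rw [div_mul_eq_mul_div, div_le_iff₀ (by positivity)] at h6
    linarith
  calc Real.exp (H / 2) ≤ c ^ 2 / 288 / v ^ 58 * Real.exp (H / 2) * Real.exp (H / 2) :=
        le_mul_of_one_le_left (Real.exp_pos _).le h8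
    _ = c ^ 2 / 144 / v ^ 58 * (Real.exp H / 2) := by rw [h7]; ring
    _ ≤ _ := mul_le_mul_of_nonneg_left hNge (by positivity)

end IsRandomCompletelyMultiplicative

theorem theorem1p2 (m : ℕ) [NeZero m] (S : Finset (ZMod m)ˣ) (hS : S.Nonempty)
    {Ω : Type*} [MeasurableSpace Ω] (P : Measure Ω) [IsProbabilityMeasure P]
    (f : Ω → (ℕ →*₀ ℝ)) (hf : IsRandomCompletelyMultiplicative P f) :
    (¬ HasNonnegRealExpansion m S →
      ∃ δ : ℝ, 0 < δ ∧ ∀ᶠ x : ℝ in atTop,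
        δ < P.real {ω | residuePartialSum m S (fun n => f ω n) x < 0}) ∧
    (HasNonnegRealExpansion m S →
      ∃ C : ℝ, 0 < C ∧
        (fun x : ℝ => P.real {ω | residuePartialSum m S (fun n => f ω n) x < 0}) =O[atTop]
          (fun x : ℝ => Real.exp (-Real.exp (Real.log x / (C * Real.log (Real.log x)))))) :=
  ⟨fun h => hf.exists_pos_eventually_lt_measure_of_not_hasNonnegRealExpansion h,
    fun h => ⟨114, by norm_num, hf.isBigO_measure_of_hasNonnegRealExpansion hS h⟩⟩
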